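/- Let $G$ be a locally compact second countable (Hausdorff) Abelian group, and let $U$ and $V$ be strongly continuous unitary representations of $G$ on separable complex Hilbert spaces $\mathcal H$ and $\mathcal K$ (possibly $\mathcal K=\mathcal H$). Let $U\otimes V$ denote the unitary representation $g\mapsto U(g)\otimes V(g)$ of $G$ on the Hilbert space tensor product $\mathcal H\otimes\mathcal K$. For a unitary representation $W$ of $G$ on a separable Hilbert space $\mathcal L$, a spectral decomposition of $W$ consists of a finite Borel measure $\sigma$ on the dual group $\widehat G$, a measurable field $\omega\mapsto\mathcal L_\omega$ of separable Hilbert spaces over $\widehat G$ with $\mathcal L_\omega\neq 0$ for $\sigma$-a.e. $\omega$, and a unitary identification $$\mathcal L=\int^\oplus_{\widehat G}\mathcal L_\omega\,d\sigma(\omega)\quad\text{under which}\quad W(g)=\int^\oplus_{\widehat G}\omega(g)I_\omega\,d\sigma(\omega),\qquad g\in G.$$ The function $m_W(\omega)=\dim\mathcal L_\omega\in\mathbb N\cup\{\infty\}$ is the spectral multiplicity function of $W$, and $\mathcal M(W)\subset\mathbb N\cup\{\infty\}$ denotes the set of its essential values, i.e. of all $n$ such that $\sigma(\{\omega: m_W(\omega)=n\})>0$.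 The representation $W$ has simple spectrum if $\mathcal M(W)=\{1\}$. A vector $\varphi\in\mathcal L$ is cyclic for $W$ if the closed linear span of $\{W(g)\varphi: g\in G\}$ is $\mathcal L$; for $\mathcal L\ne 0$, having simple spectrum is equivalent to having a cyclic vector. Suppose that there are a sequence $(g_n)_{n=1}^\infty$ in $G$, an at most countable family $(d_i)_{i\in J}$ in $G$ generating a dense subgroup of $G$, and, for each $i\in J$, a subsequence $(g_{n_k(i)})_{k=1}^\infty$ of $(g_n)$ such that, in the strong operator topology, $$U(g_n)\to I\ \text{ as } n\to\infty,\qquad\text{and}\qquad V(g_{n_k(i)})\to V(d_i)\ \text{ as } k\to\infty\ \text{ for each } i\in J.$$ Then: (1) if $U$ and $V$ have simple spectrum, then $U\otimes V$ has simple spectrum; likewise, if $U$ and $V$ have cyclic vectors, then $U\otimes V$ has a cyclic vector; (2) in general, $\mathcal M(U\otimes V)=\mathcal M(U)\,\mathcal M(V):=\{pq: p\in\mathcal M(U),\ q\in\mathcal M(V)\}$, the products being taken in $\mathbb N\cup\{\infty\}$. -/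

import Mathlib

open MeasureTheory Filter Topology
open scoped TensorProduct Pointwise ENNReal lp

noncomputable section

/-! ### Unitary representations -/

/-- A (strongly continuous) unitary representation of a topological group `G` in `H`. -/
structure UnitaryRep (G H : Type*) [Group G] [TopologicalSpace G]
    [NormedAddCommGroup H] [InnerProductSpace ℂ H] where
  /-- The underlying homomorphism into the unitary group of `H`. -/
  toHom : G →* (H ≃ₗᵢ[ℂ] H)
  /-- Strong continuity. -/
  continuous_apply : ∀ x : H, Continuous fun g : G => toHom g x

/-- The unitary operator on the completion induced by a unitary operator. -/
def LinearIsometryEquiv.toCompletion {E : Type*} [NormedAddCommGroup E] [InnerProductSpace ℂ E]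
    (T : E ≃ₗᵢ[ℂ] E) : UniformSpace.Completion E ≃ₗᵢ[ℂ] UniformSpace.Completion E where
  toLinearEquiv := LinearEquiv.ofLinearMap
    (T : E →L[ℂ] E).completion.toLinearMap (T.symm : E →L[ℂ] E).completion.toLinearMap
    (by
      ext x
      induction x using UniformSpace.Completion.induction_on with
      | hp =>
        exact isClosed_eq
          ((T : E →L[ℂ] E).completion.continuous.comp (T.symm : E →L[ℂ] E).completion.continuous)
          continuous_id
      | ih a =>
        change (T : E →L[ℂ] E).completion ((T.symm : E →L[ℂ] E).completion a) = a
        simp)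
    (by
      ext x
      induction x using UniformSpace.Completion.induction_on with
      | hp =>
        exact isClosed_eq
          ((T.symm : E →L[ℂ] E).completion.continuous.comp (T : E →L[ℂ] E).completion.continuous)
          continuous_id
      | ih a =>
        change (T.symm : E →L[ℂ] E).completion ((T : E →L[ℂ] E).completion a) = a
        simp)
  norm_map' x := by
    change ‖(T : E →L[ℂ] E).completion x‖ = ‖x‖
    induction x using UniformSpace.Completion.induction_on with
    | hp => exact isClosed_eq (T : E →L[ℂ] E).completion.continuous.norm continuous_norm
    | ih a => simp

theorem LinearIsometryEquiv.toCompletion_coe {E : Type*} [NormedAddCommGroup E]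
    [InnerProductSpace ℂ E] (T : E ≃ₗᵢ[ℂ] E) (a : E) :
    T.toCompletion (a : UniformSpace.Completion E) = (T a : UniformSpace.Completion E) := by
  change (T : E →L[ℂ] E).completion a = _
  simp

/-- The Hilbert space tensor product: the completion of the algebraic tensor product for the inner
product `⟪x ⊗ y, x' ⊗ y'⟫ = ⟪x, x'⟫ * ⟪y, y'⟫`. -/
abbrev HilbertTensor (H K : Type*) [NormedAddCommGroup H] [InnerProductSpace ℂ H]
    [NormedAddCommGroup K] [InnerProductSpace ℂ K] : Type _ :=
  UniformSpace.Completion (H ⊗[ℂ] K)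

namespace UnitaryRep

variable {G H K : Type*} [Group G] [TopologicalSpace G]
  [NormedAddCommGroup H] [InnerProductSpace ℂ H] [NormedAddCommGroup K] [InnerProductSpace ℂ K]

instance : CoeFun (UnitaryRep G H) fun _ => G → (H ≃ₗᵢ[ℂ] H) := ⟨fun U => U.toHom⟩

/-- The tensor product representation `(U ⊗ V) g = U g ⊗ V g`. -/
def tensor (U : UnitaryRep G H) (V : UnitaryRep G K) : UnitaryRep G (HilbertTensor H K) where
  toHom :=
    { toFun := fun g => (TensorProduct.congrIsometry (U g) (V g)).toCompletion
      map_one' := by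
        ext x
        induction x using UniformSpace.Completion.induction_on with
        | hp =>
          exact isClosed_eq (LinearIsometryEquiv.continuous _)
            (LinearIsometryEquiv.continuous _)
        | ih a =>
          rw [LinearIsometryEquiv.toCompletion_coe, map_one, map_one]
          have h : TensorProduct.congrIsometry (1 : H ≃ₗᵢ[ℂ] H) (1 : K ≃ₗᵢ[ℂ] K) = 1 :=
            TensorProduct.congrIsometry_refl_refl
          rw [h]
          rfl
      map_mul' := fun g h => by
        ext x
        change _ = (TensorProduct.congrIsometry (U g) (V g)).toCompletion
          ((TensorProduct.congrIsometry (U h) (V h)).toCompletion x)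
        induction x using UniformSpace.Completion.induction_on with
        | hp =>
          exact isClosed_eq (LinearIsometryEquiv.continuous _)
            ((LinearIsometryEquiv.continuous _).comp (LinearIsometryEquiv.continuous _))
        | ih a =>
          simp only [LinearIsometryEquiv.toCompletion_coe, map_mul]
          congr 1
          induction a with
          | zero => simp
          | tmul x y =>
            simp only [TensorProduct.congrIsometry_apply]
            rfl
          | add x y hx hy => rw [map_add, map_add, map_add, hx, hy] }
  continuous_apply x := by
    have halg : ∀ a : H ⊗[ℂ] K,
        Continuous fun g => TensorProduct.congrIsometry (U g) (V g) a := by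
      intro a
      induction a with
      | zero => simpa using continuous_const
      | tmul x y =>
        have h := (U.continuous_apply x).prodMk (V.continuous_apply y)
        have h2 : Continuous fun p : H × K => p.1 ⊗ₜ[ℂ] p.2 := by
          have := (TensorProduct.mkL ℂ H K).continuous₂
          exact this
        exact h2.comp h
      | add x y hx hy =>
        simp only [map_add]
        exact hx.add hy
    refine continuous_of_uniform_approx_of_continuous fun u hu => ?_
    obtain ⟨ε, hε, hu⟩ := Metric.mem_uniformity_dist.1 hu
    obtain ⟨a, ha⟩ := UniformSpace.Completion.denseRange_coe.exists_dist_lt x hε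
    refine ⟨fun g => ((TensorProduct.congrIsometry (U g) (V g) a : H ⊗[ℂ] K) :
      UniformSpace.Completion (H ⊗[ℂ] K)),
      (UniformSpace.Completion.continuous_coe _).comp (halg a), fun g => hu ?_⟩
    have h := ((TensorProduct.congrIsometry (U g) (V g)).toCompletion.dist_map x a).trans_lt ha
    rw [LinearIsometryEquiv.toCompletion_coe] at h
    exact h

/-- `φ` is cyclic: the closed linear span of its orbit is the whole space. -/
def IsCyclic (U : UnitaryRep G H) (φ : H) : Prop :=
  (Submodule.span ℂ (Set.range fun g : G => U g φ)).topologicalClosure = ⊤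

end UnitaryRep

/-! ### Direct integrals and spectral multiplicity -/

/-- The dual group carries its Borel `σ`-algebra. -/
instance PontryaginDual.instMeasurableSpaceBorel (G : Type*) [Group G] [TopologicalSpace G] :
    MeasurableSpace (PontryaginDual G) := borel _

instance PontryaginDual.instBorelSpaceBorel (G : Type*) [Group G] [TopologicalSpace G] :
    BorelSpace (PontryaginDual G) := ⟨rfl⟩

/-- A measurable field `ω ↦ H_ω` of separable Hilbert spaces over `Ω`, realized (as every such field
can be) as a field of closed subspaces of `ℓ²(ℕ, ℂ)` that is spanned by a sequence of measurable
sections. -/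
structure MeasurableHilbertField (Ω : Type*) [MeasurableSpace Ω] where
  /-- The Hilbert space over `ω`. -/
  fiber : Ω → Submodule ℂ ℓ²(ℕ, ℂ)
  /-- A fundamental sequence of measurable sections exists; in particular fibers are closed. -/
  exists_sections : ∃ s : ℕ → Ω → ℓ²(ℕ, ℂ), (∀ n, StronglyMeasurable (s n)) ∧
    ∀ ω, (Submodule.span ℂ (Set.range fun n => s n ω)).topologicalClosure = fiber ω

namespace MeasurableHilbertField

variable {Ω : Type*} [MeasurableSpace Ω]

/-- The direct integral `∫^⊕ H_ω dσ(ω)`: square-integrable measurable sections of the field, up to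
equality `σ`-almost everywhere. -/
def directIntegral (F : MeasurableHilbertField Ω) (σ : Measure Ω) :
    Submodule ℂ (Lp ℓ²(ℕ, ℂ) 2 σ) where
  carrier := {f | ∀ᵐ ω ∂σ, f ω ∈ F.fiber ω}
  add_mem' := by
    intro f g hf hg
    filter_upwards [hf, hg, Lp.coeFn_add f g] with ω h1 h2 h3
    rw [h3]
    exact (F.fiber ω).add_mem h1 h2
  zero_mem' := by
    filter_upwards [Lp.coeFn_zero ℓ²(ℕ, ℂ) 2 σ] with ω h
    rw [h]
    exact (F.fiber ω).zero_mem
  smul_mem' := by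
    intro c f hf
    filter_upwards [hf, Lp.coeFn_smul c f] with ω h1 h2
    rw [h2]
    exact (F.fiber ω).smul_mem c h1

/-- `ω ↦ dim H_ω`, with values in `ℕ ∪ {∞}`. -/
def dim (F : MeasurableHilbertField Ω) (ω : Ω) : ℕ∞ :=
  Cardinal.toENat (Module.rank ℂ (F.fiber ω))

end MeasurableHilbertField

namespace UnitaryRep

variable {G H : Type*} [CommGroup G] [TopologicalSpace G]
  [NormedAddCommGroup H] [InnerProductSpace ℂ H]

/-- A spectral decomposition of `U`: a finite measure `σ` on the dual group, a measurable field
`ω ↦ H_ω` of Hilbert spaces that are nonzero `σ`-almost everywhere (so that `σ` is a measure of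
maximal spectral type), and a unitary identification of `H` with `∫^⊕ H_ω dσ(ω)` under which `U g`
becomes multiplication by the function `ω ↦ ω(g)`. -/
structure SpectralDecomposition (U : UnitaryRep G H) where
  /-- A measure of maximal spectral type. -/
  σ : Measure (PontryaginDual G)
  isFiniteMeasure : IsFiniteMeasure σ
  /-- The field `ω ↦ H_ω`. -/
  field : MeasurableHilbertField (PontryaginDual G)
  fiber_ne_bot : ∀ᵐ ω ∂σ, field.fiber ω ≠ ⊥
  /-- The unitary identification. -/
  iso : H ≃ₗᵢ[ℂ] field.directIntegral σ
  iso_apply : ∀ (g : G) (x : H),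
    ((iso (U g x) : Lp ℓ²(ℕ, ℂ) 2 σ) : PontryaginDual G → ℓ²(ℕ, ℂ)) =ᵐ[σ]
      fun ω => ((ω g : Circle) : ℂ) • (iso x : Lp ℓ²(ℕ, ℂ) 2 σ) ω

/-- The spectral multiplicity function `ω ↦ dim H_ω`. -/
def SpectralDecomposition.multiplicity {U : UnitaryRep G H} (D : U.SpectralDecomposition)
    (ω : PontryaginDual G) : ℕ∞ :=
  D.field.dim ω

/-- `M(U)`: the set of essential values of the spectral multiplicity function of `U`, i.e. of the
values that it takes on a set of positive measure. -/
def essMultiplicities (U : UnitaryRep G H) : Set ℕ∞ :=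
  {n | ∃ D : U.SpectralDecomposition, D.σ {ω | D.multiplicity ω = n} ≠ 0}

/-- Simple spectrum: `M(U) = {1}`. -/
def HasSimpleSpectrum (U : UnitaryRep G H) : Prop :=
  U.essMultiplicities = {1}

end UnitaryRep

end

/-! Multiplicity is read off from matrix coefficients. For a total sequence `x i`, the Gram matrix
of the sections of the `x i` has Fourier transform `⟪x i, U g (x j)⟫`, which does not depend on the
spectral decomposition (`integral_ev_mul_inner_sec`), and the fiber dimension is the rank of that
Gram matrix. Uniqueness of Fourier transforms then makes the essential multiplicities intrinsic
(`ae_spanDim_ne_of_gram`, `mem_essMultiplicities_iff`).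

For `U ⊗ V` the coefficients factor, so they are Fourier transforms of data on pairs `(ω, η)`,
pushed forward along `(ω, η) ↦ ω * η`. Along subsequences, `ω (g k) → 1` and `η (g (n i k)) → η (d
i)` almost everywhere. Hence `ω * η` determines `η` on the dense subgroup generated by the `d i`,
then `η`, then `ω`. Multiplication is thus injective off a null set and has a measurable left
inverse (`exists_measurable_left_inverse_mul`); the fiber over `ω * η` acts as `H_ω ⊗ K_η`, and
multiplicities multiply (`ae_multiplicity_tensor_ne_iff`).

Existence of decompositions (`nonempty_spectralDecomposition`) comes from Bochner's theorem, proved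
by Gelfand duality for the von Neumann algebra generated by `U`, and from a splitting into
orthogonal cyclic subspaces.

Cyclic vectors need no spectral theory: a closed subspace invariant under `U ⊗ V` is invariant under
every strong limit `1 ⊗ V (d i)`, hence under all `1 ⊗ V h` (`isCyclic_tensor`). -/

/-! ### The dual group and Fourier transforms of finite measures -/

namespace PontryaginDual

section Topology

variable {G : Type*} [CommGroup G] [TopologicalSpace G]

/-- The complex number `ω g`. -/
noncomputable def ev (g : G) (ω : PontryaginDual G) : ℂ := ((ω g : Circle) : ℂ)

theorem norm_ev (g : G) (ω : PontryaginDual G) : ‖ev g ω‖ = 1 := Circle.norm_coe _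

theorem ev_one (ω : PontryaginDual G) : ev 1 ω = 1 := by
  rw [ev, _root_.map_one]; rfl

theorem ev_mul (g g' : G) (ω : PontryaginDual G) : ev (g * g') ω = ev g ω * ev g' ω := by
  rw [ev, _root_.map_mul]; rfl

theorem ev_inv (g : G) (ω : PontryaginDual G) : ev g⁻¹ ω = star (ev g ω) := by
  rw [ev, _root_.map_inv, Circle.coe_inv_eq_conj]; rfl

theorem ev_mul_apply (g : G) (ω η : PontryaginDual G) : ev g (ω * η) = ev g ω * ev g η := rfl

theorem ext_ev {ω η : PontryaginDual G} (h : ∀ g, ev g ω = ev g η) : ω = η :=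
  PontryaginDual.ext fun g => Circle.ext (h g)

variable [LocallyCompactSpace G]

instance instContinuousEval : ContinuousEval (PontryaginDual G) G Circle :=
  inferInstanceAs (ContinuousEval (G →ₜ* Circle) G Circle)

theorem continuous_ev (g : G) : Continuous (ev g : PontryaginDual G → ℂ) :=
  continuous_subtype_val.comp (continuous_eval_const g)

theorem integrable_eval_mul {σ : Measure (PontryaginDual G)} {F : PontryaginDual G → ℂ}
    (hF : Integrable F σ) (g : G) : Integrable (fun ω => ev g ω * F ω) σ :=
  hF.bdd_mul (c := 1) (continuous_ev g).aestronglyMeasurable (Eventually.of_forall fun ω => (norm_ev g ω).le)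

instance instSecondCountableTopology [SecondCountableTopology G] :
    SecondCountableTopology (PontryaginDual G) :=
  (ContinuousMonoidHom.isInducing_toContinuousMap G Circle).secondCountableTopology

/-- A locally compact group is complete, and second countability makes its uniformity countably
generated. Polishness is used twice: for uniqueness of measures and for Lusin–Souslin arguments. -/
instance instPolishSpace [IsTopologicalGroup G] [SecondCountableTopology G] :
    PolishSpace (PontryaginDual G) := by
  let _ : UniformSpace (PontryaginDual G) := IsTopologicalGroup.rightUniformSpace _
  have : IsUniformGroup (PontryaginDual G) := isUniformGroup_of_commGroup
  have : (uniformity (PontryaginDual G)).IsCountablyGenerated :=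
    IsUniformGroup.uniformity_countably_generated
  have : CompleteSpace (PontryaginDual G) :=
    IsRightUniformGroup.completeSpace_of_weaklyLocallyCompactSpace
  infer_instance

end Topology

variable {G : Type*} [CommGroup G] [TopologicalSpace G] [IsTopologicalGroup G]
  [LocallyCompactSpace G] [SecondCountableTopology G]

/-- Evaluation at `g`, as a bounded continuous function on the dual group. -/
noncomputable def evalBounded (g : G) : BoundedContinuousFunction (PontryaginDual G) ℂ :=
  BoundedContinuousFunction.ofNormedAddCommGroup (ev g)
    (continuous_ev g) 1 fun ω => (norm_ev g ω).le

/-- The evaluations span a point-separating star subalgebra of bounded continuous functions, and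
integrals over such an algebra determine a finite measure on a Polish space. -/
theorem measure_ext {μ ν : Measure (PontryaginDual G)} [IsFiniteMeasure μ] [IsFiniteMeasure ν]
    (h : ∀ g : G, ∫ ω, ev g ω ∂μ = ∫ ω, ev g ω ∂ν) : μ = ν := by
  set s : Set (BoundedContinuousFunction (PontryaginDual G) ℂ) := Set.range evalBounded with hs
  -- Evaluations are closed under products and conjugation, so the star algebra they generate is
  -- just their linear span.
  have hclosure : (Submonoid.closure (s ∪ star s) : Set _) ⊆ s := by
    intro f hf
    induction hf using Submonoid.closure_induction with
    | mem f hf =>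
      rcases hf with hf | hf
      · exact hf
      · obtain ⟨g, hg⟩ := hf
        refine ⟨g⁻¹, ?_⟩
        rw [← star_star f, ← hg]
        ext ω
        simp [evalBounded, ev_inv]
    | one => exact ⟨1, by ext ω; simp [evalBounded, ev_one]⟩
    | mul f f' _ _ hf hf' =>
      obtain ⟨g, rfl⟩ := hf
      obtain ⟨g', rfl⟩ := hf'
      exact ⟨g * g', by ext ω; simp [evalBounded, ev_mul]⟩
  refine ext_of_forall_mem_subalgebra_integral_eq_of_polish (𝕜 := ℂ)
    (A := StarAlgebra.adjoin ℂ s) ?_ ?_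
  · intro ω ω' hne
    obtain ⟨g, hg⟩ : ∃ g, ev g ω ≠ ev g ω' := by
      by_contra! hc
      exact hne (ext_ev hc)
    refine ⟨evalBounded g, ⟨BoundedContinuousFunction.toContinuousMap (evalBounded g),
      ⟨evalBounded g, StarAlgebra.subset_adjoin ℂ s ⟨g, rfl⟩, rfl⟩, rfl⟩, ?_⟩
    simpa [evalBounded] using hg
  · intro f hf
    replace hf : f ∈ Submodule.span ℂ (Submonoid.closure (s ∪ star s) : Set _) := by
      rw [← StarAlgebra.adjoin_eq_span]
      exact hf
    replace hf := Submodule.span_mono hclosure hf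
    induction hf using Submodule.span_induction with
    | mem f hf =>
      obtain ⟨g, rfl⟩ := hf
      exact h g
    | zero => simp
    | add f f' _ _ hf hf' =>
      simp only [BoundedContinuousFunction.coe_add, Pi.add_apply]
      rw [integral_add (f.integrable _) (f'.integrable _),
        integral_add (f.integrable _) (f'.integrable _), hf, hf']
    | smul c f _ hf =>
      simp only [BoundedContinuousFunction.coe_smul]
      rw [integral_smul, integral_smul, hf]

/-- The finite measures with densities `F⁺` and `F⁻` have the same Fourier transform, hence
coincide; since `F⁺` and `F⁻` are never both positive, both vanish almost everywhere. -/
theorem ae_eq_zero_of_forall_integral_eval_mul_ofReal {σ : Measure (PontryaginDual G)}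
    {F : PontryaginDual G → ℝ}
    (hF : Integrable F σ) (h : ∀ g : G, ∫ ω, ev g ω * (F ω : ℂ) ∂σ = 0) :
    F =ᵐ[σ] 0 := by
  have hfin : ∀ {f : PontryaginDual G → ℝ}, Integrable f σ →
      ∫⁻ ω, ENNReal.ofReal (f ω) ∂σ ≠ ∞ := fun hf =>
    ((lintegral_mono fun ω => Real.ofReal_le_enorm _).trans_lt hf.hasFiniteIntegral).ne
  have : IsFiniteMeasure (σ.withDensity fun ω => ENNReal.ofReal (F ω)) :=
    isFiniteMeasure_withDensity (hfin hF)
  have : IsFiniteMeasure (σ.withDensity fun ω => ENNReal.ofReal (-F ω)) :=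
    isFiniteMeasure_withDensity (hfin hF.neg)
  have hm := hF.aestronglyMeasurable.aemeasurable
  have hm' : AEMeasurable (fun ω => -F ω) σ := hm.neg
  have key : (σ.withDensity fun ω => ENNReal.ofReal (F ω)) =
      σ.withDensity fun ω => ENNReal.ofReal (-F ω) := by
    refine measure_ext fun g => ?_
    rw [integral_withDensity_eq_integral_toReal_smul₀ hm.ennreal_ofReal (by simp),
      integral_withDensity_eq_integral_toReal_smul₀ hm'.ennreal_ofReal (by simp),
      ← sub_eq_zero, ← integral_sub, ← h g]
    · refine integral_congr_ae (Eventually.of_forall fun ω => ?_)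
      simp only [Complex.real_smul, ← sub_mul]
      rw [mul_comm, ← Complex.ofReal_sub]
      congr 2
      rcases le_total 0 (F ω) with h0 | h0
      · rw [ENNReal.toReal_ofReal h0, ENNReal.ofReal_of_nonpos (by linarith)]; simp
      · rw [ENNReal.toReal_ofReal (by linarith : 0 ≤ -F ω), ENNReal.ofReal_of_nonpos h0]; simp
    · simp only [Complex.real_smul, mul_comm ((_ : ℝ) : ℂ)]
      exact integrable_eval_mul (Integrable.ofReal hF.real_toNNReal) g
    · simp only [Complex.real_smul, mul_comm ((_ : ℝ) : ℂ)]
      exact integrable_eval_mul (Integrable.ofReal hF.neg.real_toNNReal) g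
  rw [withDensity_eq_iff hm.ennreal_ofReal hm'.ennreal_ofReal (hfin hF)] at key
  filter_upwards [key] with ω hω
  rcases le_total 0 (F ω) with h0 | h0
  · rw [ENNReal.ofReal_of_nonpos (by linarith : -F ω ≤ 0), ENNReal.ofReal_eq_zero] at hω
    exact le_antisymm hω h0
  · rw [ENNReal.ofReal_of_nonpos h0, eq_comm, ENNReal.ofReal_eq_zero] at hω
    exact le_antisymm h0 (show (0 : ℝ) ≤ F ω by linarith)

/-- An integrable function on the dual group whose Fourier transform vanishes is zero. -/
theorem ae_eq_zero_of_forall_integral_eval_mul {σ : Measure (PontryaginDual G)}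
    {F : PontryaginDual G → ℂ} (hF : Integrable F σ)
    (h : ∀ g : G, ∫ ω, ev g ω * F ω ∂σ = 0) : F =ᵐ[σ] 0 := by
  -- Conjugating the hypothesis at `g⁻¹` gives the same vanishing for the conjugate of `F`, and so
  -- for its real and imaginary parts.
  have hconj : ∀ g : G, ∫ ω, ev g ω * star (F ω) ∂σ = 0 := by
    intro g
    have h' := congrArg star (h g⁻¹)
    rw [star_zero, Complex.star_def, ← integral_conj] at h'
    rw [← h']
    refine integral_congr_ae (Eventually.of_forall fun ω => ?_)
    simp [ev_inv]
  have hFc : Integrable (fun ω => star (F ω)) σ :=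
    (LinearIsometryEquiv.integrable_comp_iff (Complex.conjLIE : ℂ ≃ₗᵢ[ℝ] ℂ)).2 hF
  have hre : (fun ω => (F ω).re) =ᵐ[σ] 0 := by
    refine ae_eq_zero_of_forall_integral_eval_mul_ofReal hF.re fun g => ?_
    have : ∀ ω : PontryaginDual G, ev g ω * ((F ω).re : ℂ) =
        2⁻¹ * (ev g ω * F ω + ev g ω * star (F ω)) := by
      intro ω
      rw [Complex.re_eq_add_conj, Complex.star_def]
      ring
    simp_rw [this]
    rw [integral_const_mul, integral_add (integrable_eval_mul hF g) (integrable_eval_mul hFc g),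
      h, hconj]
    simp
  have him : (fun ω => (F ω).im) =ᵐ[σ] 0 := by
    refine ae_eq_zero_of_forall_integral_eval_mul_ofReal hF.im fun g => ?_
    have : ∀ ω : PontryaginDual G, ev g ω * ((F ω).im : ℂ) =
        (2 * Complex.I)⁻¹ *
          (ev g ω * F ω - ev g ω * star (F ω)) := by
      intro ω
      rw [Complex.im_eq_sub_conj, Complex.star_def]
      ring
    simp_rw [this]
    rw [integral_const_mul, integral_sub (integrable_eval_mul hF g) (integrable_eval_mul hFc g),
      h, hconj]
    simp
  filter_upwards [hre, him] with ω h1 h2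
  exact Complex.ext h1 h2

end PontryaginDual

/-! ### Gram matrices and dimensions of spans -/

section Gram

variable {ι E E' : Type*} [NormedAddCommGroup E] [InnerProductSpace ℂ E]
  [NormedAddCommGroup E'] [InnerProductSpace ℂ E']

/-- The dimension of the linear span of a family, with values in `ℕ ∪ {∞}`. -/
noncomputable def spanDim {ι E : Type*} [AddCommGroup E] [Module ℂ E] (v : ι → E) : ℕ∞ :=
  Cardinal.toENat (Module.rank ℂ (Submodule.span ℂ (Set.range v)))

theorem inner_linearCombination (v : ι → E) (a b : ι →₀ ℂ) :
    inner ℂ (Finsupp.linearCombination ℂ v a) (Finsupp.linearCombination ℂ v b) =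
      a.sum fun i x => b.sum fun j y => star x * y * inner ℂ (v i) (v j) := by
  simp only [Finsupp.linearCombination_apply, Finsupp.sum, sum_inner]
  refine Finset.sum_congr rfl fun i _ => ?_
  simp only [inner_sum, inner_smul_left, inner_smul_right]
  refine Finset.sum_congr rfl fun j _ => ?_
  rw [RCLike.star_def]
  ring

theorem linearCombination_eq_zero_iff_of_gram {v : ι → E} {w : ι → E'} {c : ℂ} (hc : c ≠ 0)
    (h : ∀ i j, inner ℂ (v i) (v j) = c * inner ℂ (w i) (w j)) (a : ι →₀ ℂ) :
    Finsupp.linearCombination ℂ v a = 0 ↔ Finsupp.linearCombination ℂ w a = 0 := by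
  rw [← inner_self_eq_zero (𝕜 := ℂ), ← inner_self_eq_zero (𝕜 := ℂ) (E := E'),
    inner_linearCombination, inner_linearCombination]
  have : (a.sum fun i x => a.sum fun j y => star x * y * inner ℂ (v i) (v j)) =
      c * a.sum fun i x => a.sum fun j y => star x * y * inner ℂ (w i) (w j) := by
    simp only [Finsupp.sum, Finset.mul_sum, h]
    exact Finset.sum_congr rfl fun i _ => Finset.sum_congr rfl fun j _ => by ring
  rw [this, mul_eq_zero, or_iff_right hc]

/-- Proportional Gram matrices give the same linear relations, so both spans are the quotient of `ι
→₀ ℂ` by the same kernel. The factor `c` will be a ratio of densities. -/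
theorem spanDim_eq_of_gram {v : ι → E} {w : ι → E'} {c : ℂ} (hc : c ≠ 0)
    (h : ∀ i j, inner ℂ (v i) (v j) = c * inner ℂ (w i) (w j)) : spanDim v = spanDim w := by
  have hker : LinearMap.ker (Finsupp.linearCombination ℂ v) =
      LinearMap.ker (Finsupp.linearCombination ℂ w) := by
    ext a
    exact linearCombination_eq_zero_iff_of_gram hc h a
  have e := ((Finsupp.linearCombination ℂ v).quotKerEquivRange.symm.trans
    (Submodule.quotEquivOfEq _ _ hker)).trans (Finsupp.linearCombination ℂ w).quotKerEquivRange
  rw [Finsupp.range_linearCombination, Finsupp.range_linearCombination] at e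
  rw [spanDim, spanDim, ← Cardinal.toENat_lift, e.lift_rank_eq, Cardinal.toENat_lift]

theorem denseRange_linearCombination {u : ι → E}
    (hu : (Submodule.span ℂ (Set.range u)).topologicalClosure = ⊤) :
    DenseRange (Finsupp.linearCombination ℂ u) := by
  rw [← Finsupp.range_linearCombination, ← Submodule.dense_iff_topologicalClosure_eq_top] at hu
  exact hu

/-- Norms of linear combinations depend only on the Gram matrix, so `v i ↦ w i` is isometric between
dense subspaces and extends to the completions. -/
theorem exists_linearIsometryEquiv_of_gram [CompleteSpace E] [CompleteSpace E']
    {v : ι → E} {w : ι → E'}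
    (h : ∀ i j, inner ℂ (v i) (v j) = inner ℂ (w i) (w j))
    (hv : (Submodule.span ℂ (Set.range v)).topologicalClosure = ⊤)
    (hw : (Submodule.span ℂ (Set.range w)).topologicalClosure = ⊤) :
    ∃ T : E ≃ₗᵢ[ℂ] E', ∀ i, T (v i) = w i := by
  have hnorm : ∀ a : ι →₀ ℂ, ‖Finsupp.linearCombination ℂ w (LinearEquiv.refl ℂ _ a)‖ =
      ‖Finsupp.linearCombination ℂ v a‖ := by
    intro a
    rw [@norm_eq_sqrt_re_inner ℂ, @norm_eq_sqrt_re_inner ℂ _ _ _ _ (_ : E),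
      LinearEquiv.refl_apply, inner_linearCombination, inner_linearCombination]
    simp only [h]
  refine ⟨(LinearEquiv.refl ℂ (ι →₀ ℂ)).extendOfIsometry (Finsupp.linearCombination ℂ v)
    (Finsupp.linearCombination ℂ w) (denseRange_linearCombination hv) (denseRange_linearCombination hw) hnorm, fun i => ?_⟩
  have := LinearEquiv.extendOfIsometry_eq (LinearEquiv.refl ℂ (ι →₀ ℂ))
    (Finsupp.linearCombination ℂ v)
    (Finsupp.linearCombination ℂ w) (denseRange_linearCombination hv) (denseRange_linearCombination hw) hnorm (Finsupp.single i 1)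
  simpa using this

end Gram

/-- A dominating measure lets data integrated against two unrelated measures be compared pointwise.
-/
theorem exists_common_withDensity {Ω : Type*} [MeasurableSpace Ω] (σ σ' : Measure Ω)
    [IsFiniteMeasure σ] [IsFiniteMeasure σ'] :
    ∃ (ρ : Measure Ω) (r r' : Ω → ℝ≥0∞), Measurable r ∧ Measurable r' ∧
      (∀ᵐ ω ∂ρ, r ω < ∞) ∧ (∀ᵐ ω ∂ρ, r' ω < ∞) ∧
      σ = ρ.withDensity r ∧ σ' = ρ.withDensity r' :=
  ⟨σ + σ', σ.rnDeriv (σ + σ'), σ'.rnDeriv (σ + σ'), Measure.measurable_rnDeriv _ _,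
    Measure.measurable_rnDeriv _ _, Measure.rnDeriv_lt_top _ _, Measure.rnDeriv_lt_top _ _,
    (Measure.withDensity_rnDeriv_eq _ _
      (Measure.le_add_right le_rfl).absolutelyContinuous).symm,
    (Measure.withDensity_rnDeriv_eq _ _
      (Measure.le_add_left le_rfl).absolutelyContinuous).symm⟩

open PontryaginDual in
/-- Two fields of families of vectors over the dual group whose Gram matrices have the same
Fourier transforms span spaces of the same dimensions. -/
theorem ae_spanDim_ne_of_gram {G : Type*} [CommGroup G] [TopologicalSpace G] [IsTopologicalGroup G]
    [LocallyCompactSpace G] [SecondCountableTopology G]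
    {ι E E' : Type*} [Countable ι] [NormedAddCommGroup E] [InnerProductSpace ℂ E]
    [NormedAddCommGroup E'] [InnerProductSpace ℂ E']
    {σ σ' : Measure (PontryaginDual G)} [IsFiniteMeasure σ] [IsFiniteMeasure σ']
    {v : PontryaginDual G → ι → E} {v' : PontryaginDual G → ι → E'}
    (hi : ∀ i j, Integrable (fun ω => inner ℂ (v ω i) (v ω j)) σ)
    (hi' : ∀ i j, Integrable (fun ω => inner ℂ (v' ω i) (v' ω j)) σ')
    (h : ∀ g i j, ∫ ω, ev g ω * inner ℂ (v ω i) (v ω j) ∂σ =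
      ∫ ω, ev g ω * inner ℂ (v' ω i) (v' ω j) ∂σ')
    (hne : ∀ᵐ ω ∂σ, ∃ i, v ω i ≠ 0) {n : ℕ∞}
    (hn : ∀ᵐ ω ∂σ', spanDim (v' ω) ≠ n) : ∀ᵐ ω ∂σ, spanDim (v ω) ≠ n := by
  obtain ⟨ρ, r, r', hr, hr', hlt, hlt', rfl, rfl⟩ := exists_common_withDensity σ σ'
  rw [ae_withDensity_iff hr] at hne ⊢
  rw [ae_withDensity_iff hr'] at hn
  -- The difference of the two density-weighted Gram entries is integrable for `ρ` and has vanishing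
  -- Fourier transform.
  have key : ∀ i j, ∀ᵐ ω ∂ρ, ((r ω).toReal : ℂ) * inner ℂ (v ω i) (v ω j) =
      ((r' ω).toReal : ℂ) * inner ℂ (v' ω i) (v' ω j) := by
    intro i j
    have h1 := (integrable_withDensity_iff_integrable_smul' hr hlt).1 (hi i j)
    have h2 := (integrable_withDensity_iff_integrable_smul' hr' hlt').1 (hi' i j)
    simp only [Complex.real_smul] at h1 h2
    have h3 := ae_eq_zero_of_forall_integral_eval_mul (h1.sub h2) fun g => by
      have h4 := h g i j
      rw [integral_withDensity_eq_integral_toReal_smul hr hlt,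
        integral_withDensity_eq_integral_toReal_smul hr' hlt', ← sub_eq_zero] at h4
      rw [← h4, ← integral_sub]
      · refine integral_congr_ae (Eventually.of_forall fun ω => ?_)
        simp only [Pi.sub_apply, Complex.real_smul]
        ring
      · refine (integrable_eval_mul h1 g).congr (Eventually.of_forall fun ω => ?_)
        simp only [Complex.real_smul]
        ring
      · refine (integrable_eval_mul h2 g).congr (Eventually.of_forall fun ω => ?_)
        simp only [Complex.real_smul]
        ring
    filter_upwards [h3] with ω hω
    exact sub_eq_zero.1 hω
  replace key := ae_all_iff.2 fun i => ae_all_iff.2 fun j => key i j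
  filter_upwards [key, hlt, hlt', hne, hn] with ω hω h1 h2 h3 h4 h5
  have hr0 : ((r ω).toReal : ℂ) ≠ 0 := by
    exact_mod_cast (ENNReal.toReal_pos h5 h1.ne).ne'
  obtain ⟨i, hi0⟩ := h3 h5
  -- Some `v ω i` is nonzero, so a diagonal entry on the left is nonzero. This forces `r' ω ≠ 0`, so
  -- that `hn` applies at `ω`.
  have hr0' : ((r' ω).toReal : ℂ) ≠ 0 := by
    intro h0
    have := hω i i
    rw [h0, zero_mul, mul_eq_zero, or_iff_right hr0, inner_self_eq_zero] at this
    exact hi0 this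
  have hr1' : r' ω ≠ 0 := fun h0 => hr0' (by simp [h0])
  rw [spanDim_eq_of_gram (mul_ne_zero (inv_ne_zero hr0) hr0') (w := v' ω)]
  · exact h4 hr1'
  · intro i j
    rw [mul_assoc, ← hω, inv_mul_cancel_left₀ hr0]

/-! ### Spectral decompositions and Gram matrices -/

/-- A finite-dimensional span is already closed; otherwise both sides are `⊤`. This works because
infinite cardinals are not distinguished in `ℕ∞`. -/
theorem toENat_rank_eq_spanDim {ι E : Type*} [NormedAddCommGroup E] [InnerProductSpace ℂ E]
    {v : ι → E} {F : Submodule ℂ E}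
    (h : (Submodule.span ℂ (Set.range v)).topologicalClosure = F) :
    Cardinal.toENat (Module.rank ℂ F) = spanDim v := by
  by_cases hfin : FiniteDimensional ℂ (Submodule.span ℂ (Set.range v))
  · rw [← h, (Submodule.closed_of_finiteDimensional _).submodule_topologicalClosure_eq, spanDim]
  · have h1 : Cardinal.aleph0 ≤ Module.rank ℂ (Submodule.span ℂ (Set.range v)) := by
      rw [← not_lt]
      exact fun hlt => hfin (Module.rank_lt_aleph0_iff.1 hlt)
    have h2 : Cardinal.aleph0 ≤ Module.rank ℂ F :=
      h1.trans (Submodule.rank_mono (h ▸ Submodule.le_topologicalClosure _))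
    rw [spanDim, Cardinal.toENat_eq_top.2 h1, Cardinal.toENat_eq_top.2 h2]

namespace MeasurableHilbertField

variable {Ω : Type*} [MeasurableSpace Ω] {F : MeasurableHilbertField Ω} {σ : Measure Ω}

theorem isClosed_fiber (F : MeasurableHilbertField Ω) (ω : Ω) :
    IsClosed (F.fiber ω : Set ℓ²(ℕ, ℂ)) := by
  obtain ⟨s, -, hs⟩ := F.exists_sections
  rw [← hs ω]
  exact Submodule.isClosed_topologicalClosure _

theorem ae_exists_subseq_tendsto {u : ℕ → Lp ℓ²(ℕ, ℂ) 2 σ} {f : Lp ℓ²(ℕ, ℂ) 2 σ}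
    (h : Tendsto u atTop (𝓝 f)) :
    ∃ ns : ℕ → ℕ, StrictMono ns ∧ ∀ᵐ ω ∂σ, Tendsto (fun k => u (ns k) ω) atTop (𝓝 (f ω)) :=
  (tendstoInMeasure_of_tendsto_Lp h).exists_seq_tendsto_ae

/-- An `L²`-convergent sequence has an almost everywhere convergent subsequence, and each fiber is
closed. -/
theorem isClosed_directIntegral (F : MeasurableHilbertField Ω) (σ : Measure Ω) :
    IsClosed (F.directIntegral σ : Set (Lp ℓ²(ℕ, ℂ) 2 σ)) := by
  refine IsSeqClosed.isClosed fun u f hu hf => ?_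
  obtain ⟨ns, -, hns⟩ := ae_exists_subseq_tendsto hf
  have hmem := ae_all_iff.2 fun k => (hu k : ∀ᵐ ω ∂σ, u k ω ∈ F.fiber ω)
  change ∀ᵐ ω ∂σ, f ω ∈ F.fiber ω
  filter_upwards [hns, hmem] with ω h1 h2
  exact (F.isClosed_fiber ω).mem_of_tendsto h1 (Eventually.of_forall fun k => h2 _)

theorem ae_mem_span_of_mem_span {ι : Type*} {f : ι → F.directIntegral σ}
    {u : F.directIntegral σ} (hu : u ∈ Submodule.span ℂ (Set.range f)) :
    ∀ᵐ ω ∂σ, (u : Lp ℓ²(ℕ, ℂ) 2 σ) ω ∈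
      Submodule.span ℂ (Set.range fun i => (f i : Lp ℓ²(ℕ, ℂ) 2 σ) ω) := by
  induction hu using Submodule.span_induction with
  | mem u hu =>
    obtain ⟨i, rfl⟩ := hu
    exact Eventually.of_forall fun ω => Submodule.subset_span ⟨i, rfl⟩
  | zero =>
    filter_upwards [Lp.coeFn_zero ℓ²(ℕ, ℂ) 2 σ] with ω h
    rw [Submodule.coe_zero, h]
    exact Submodule.zero_mem _
  | add u w _ _ hu hw =>
    filter_upwards [hu, hw, Lp.coeFn_add (u : Lp ℓ²(ℕ, ℂ) 2 σ) w] with ω h1 h2 h3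
    rw [Submodule.coe_add, h3]
    exact Submodule.add_mem _ h1 h2
  | smul c u _ hu =>
    filter_upwards [hu, Lp.coeFn_smul c (u : Lp ℓ²(ℕ, ℂ) 2 σ)] with ω h1 h2
    rw [Submodule.coe_smul, h2]
    exact Submodule.smul_mem _ c h1

/-- A total sequence in the direct integral is total in almost every fiber. -/
theorem ae_closure_span_eq [IsFiniteMeasure σ] {ι : Type*} [Countable ι]
    {f : ι → F.directIntegral σ}
    (hf : (Submodule.span ℂ (Set.range f)).topologicalClosure = ⊤) :
    ∀ᵐ ω ∂σ, (Submodule.span ℂ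
      (Set.range fun i => (f i : Lp ℓ²(ℕ, ℂ) 2 σ) ω)).topologicalClosure = F.fiber ω := by
  obtain ⟨s, hsm, hs⟩ := F.exists_sections
  have hmem := ae_all_iff.2 fun i => ((f i).2 : ∀ᵐ ω ∂σ, (f i : Lp ℓ²(ℕ, ℂ) 2 σ) ω ∈ F.fiber ω)
  have hsec : ∀ m, ∀ᵐ ω ∂σ, s m ω ∈ (Submodule.span ℂ
      (Set.range fun i => (f i : Lp ℓ²(ℕ, ℂ) 2 σ) ω)).topologicalClosure := by
    intro m
    have hpos : ∀ ω, (0 : ℝ) < 1 + ‖s m ω‖ := fun ω => by positivity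
    -- The section `s m` need not be square integrable; damping it by a positive scalar function
    -- makes it bounded, which suffices as `σ` is finite. The factor is removed pointwise at the
    -- end.
    have htm : MemLp (fun ω => ((1 + ‖s m ω‖)⁻¹ : ℝ) • s m ω) 2 σ := by
      refine MemLp.of_bound (C := 1) (StronglyMeasurable.aestronglyMeasurable ?_)
        (Eventually.of_forall fun ω => ?_)
      · exact (((hsm m).norm.measurable.const_add 1).inv.stronglyMeasurable).smul (hsm m)
      · rw [norm_smul, norm_inv, Real.norm_of_nonneg (hpos ω).le, inv_mul_le_iff₀ (hpos ω)]
        linarith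
    have htF : htm.toLp ∈ F.directIntegral σ := by
      change ∀ᵐ ω ∂σ, _
      filter_upwards [htm.coeFn_toLp] with ω hω
      rw [hω, ← hs ω]
      exact Submodule.smul_of_tower_mem _ _
        (Submodule.le_topologicalClosure _ (Submodule.subset_span ⟨m, rfl⟩))
    have hcl : (⟨htm.toLp, htF⟩ : F.directIntegral σ) ∈
        closure (Submodule.span ℂ (Set.range f) : Set (F.directIntegral σ)) := by
      rw [← Submodule.topologicalClosure_coe, hf]
      trivial
    obtain ⟨u, hu, hlim⟩ := mem_closure_iff_seq_limit.1 hcl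
    obtain ⟨ns, -, hns⟩ := ae_exists_subseq_tendsto
      ((continuous_subtype_val.tendsto _).comp hlim)
    have huspan := ae_all_iff.2 fun k => ae_mem_span_of_mem_span (hu k)
    filter_upwards [hns, huspan, htm.coeFn_toLp] with ω h1 h2 h3
    rw [h3] at h1
    have h4 : ((1 + ‖s m ω‖)⁻¹ : ℝ) • s m ω ∈ (Submodule.span ℂ
        (Set.range fun i => (f i : Lp ℓ²(ℕ, ℂ) 2 σ) ω)).topologicalClosure :=
      (Submodule.isClosed_topologicalClosure _).mem_of_tendsto h1
        (Eventually.of_forall fun k => Submodule.le_topologicalClosure _ (h2 _))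
    have h5 := Submodule.smul_of_tower_mem _ (1 + ‖s m ω‖) h4
    rwa [smul_inv_smul₀ (hpos ω).ne'] at h5
  filter_upwards [hmem, ae_all_iff.2 hsec] with ω h1 h2
  refine le_antisymm ?_ ?_
  · refine Submodule.topologicalClosure_minimal _ ?_ (F.isClosed_fiber ω)
    rw [Submodule.span_le]
    rintro _ ⟨i, rfl⟩
    exact h1 i
  · rw [← hs ω]
    refine Submodule.topologicalClosure_minimal _ ?_ (Submodule.isClosed_topologicalClosure _)
    rw [Submodule.span_le]
    rintro _ ⟨m, rfl⟩
    exact h2 m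

end MeasurableHilbertField

namespace UnitaryRep

open PontryaginDual

variable {G H : Type*} [CommGroup G] [TopologicalSpace G]
  [NormedAddCommGroup H] [InnerProductSpace ℂ H] {U : UnitaryRep G H}

namespace SpectralDecomposition

/-- The section of the field that corresponds to a vector. -/
noncomputable def sec (D : U.SpectralDecomposition) (x : H) (ω : PontryaginDual G) : ℓ²(ℕ, ℂ) :=
  (D.iso x : Lp ℓ²(ℕ, ℂ) 2 D.σ) ω

theorem integrable_inner_sec (D : U.SpectralDecomposition) (x y : H) :
    Integrable (fun ω => inner ℂ (D.sec x ω) (D.sec y ω)) D.σ :=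
  L2.integrable_inner _ _

theorem sec_apply (D : U.SpectralDecomposition) (g : G) (x : H) :
    D.sec (U g x) =ᵐ[D.σ] fun ω => ev g ω • D.sec x ω :=
  D.iso_apply g x

/-- The right side does not mention `D`: this is what makes different decompositions, and
decompositions of tensor products, comparable. -/
theorem integral_ev_mul_inner_sec (D : U.SpectralDecomposition) (g : G) (x y : H) :
    ∫ ω, ev g ω * inner ℂ (D.sec x ω) (D.sec y ω) ∂D.σ = inner ℂ x (U g y) := by
  rw [← D.iso.inner_map_map, Submodule.coe_inner, L2.inner_def]
  refine integral_congr_ae ?_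
  filter_upwards [D.sec_apply g y] with ω hω
  change _ = inner ℂ (D.sec x ω) (D.sec (U g y) ω)
  rw [hω, inner_smul_right]

theorem ae_closure_span_sec (D : U.SpectralDecomposition) {ι : Type*} [Countable ι] {x : ι → H}
    (hx : (Submodule.span ℂ (Set.range x)).topologicalClosure = ⊤) :
    ∀ᵐ ω ∂D.σ, (Submodule.span ℂ
      (Set.range fun i => D.sec (x i) ω)).topologicalClosure = D.field.fiber ω := by
  have := D.isFiniteMeasure
  refine MeasurableHilbertField.ae_closure_span_eq (f := fun i => D.iso (x i)) ?_
  rw [← Submodule.dense_iff_topologicalClosure_eq_top] at hx ⊢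
  have h := D.iso.surjective.denseRange.dense_image D.iso.continuous hx
  have e : Submodule.span ℂ (Set.range fun i => D.iso (x i)) =
      (Submodule.span ℂ (Set.range x)).map D.iso.toLinearEquiv.toLinearMap := by
    rw [Submodule.map_span, ← Set.range_comp]
    rfl
  rw [e]
  exact h

theorem ae_multiplicity_eq (D : U.SpectralDecomposition) {ι : Type*} [Countable ι] {x : ι → H}
    (hx : (Submodule.span ℂ (Set.range x)).topologicalClosure = ⊤) :
    ∀ᵐ ω ∂D.σ, D.multiplicity ω = spanDim fun i => D.sec (x i) ω := by
  filter_upwards [D.ae_closure_span_sec hx] with ω hω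
  exact toENat_rank_eq_spanDim hω

theorem ae_exists_sec_ne_zero (D : U.SpectralDecomposition) {ι : Type*} [Countable ι] {x : ι → H}
    (hx : (Submodule.span ℂ (Set.range x)).topologicalClosure = ⊤) :
    ∀ᵐ ω ∂D.σ, ∃ i, D.sec (x i) ω ≠ 0 := by
  filter_upwards [D.ae_closure_span_sec hx, D.fiber_ne_bot] with ω h1 h2
  by_contra! hc
  refine h2 ?_
  rw [← h1, eq_bot_iff]
  refine Submodule.topologicalClosure_minimal _ ?_ (by simp)
  rw [Submodule.span_le]
  rintro _ ⟨i, rfl⟩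
  simp [hc i]

end SpectralDecomposition

theorem exists_seq_closure_span_eq_top (H : Type*) [NormedAddCommGroup H] [InnerProductSpace ℂ H]
    [TopologicalSpace.SeparableSpace H] :
    ∃ x : ℕ → H, (Submodule.span ℂ (Set.range x)).topologicalClosure = ⊤ := by
  refine ⟨TopologicalSpace.denseSeq H, ?_⟩
  rw [← Submodule.dense_iff_topologicalClosure_eq_top]
  exact (TopologicalSpace.denseRange_denseSeq H).mono Submodule.subset_span

/-- The essential multiplicities can be computed from any one spectral decomposition. -/
theorem mem_essMultiplicities_iff [IsTopologicalGroup G] [LocallyCompactSpace G]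
    [SecondCountableTopology G] [TopologicalSpace.SeparableSpace H]
    (D : U.SpectralDecomposition) (n : ℕ∞) :
    n ∈ U.essMultiplicities ↔ ¬ ∀ᵐ ω ∂D.σ, D.multiplicity ω ≠ n := by
  have hiff : ∀ D : U.SpectralDecomposition, D.σ {ω | D.multiplicity ω = n} ≠ 0 ↔
      ¬ ∀ᵐ ω ∂D.σ, D.multiplicity ω ≠ n := by
    intro D
    simp [ae_iff]
  refine ⟨fun ⟨D', hD'⟩ hD => (hiff D').1 hD' ?_, fun h => ⟨D, (hiff D).2 h⟩⟩
  obtain ⟨x, hx⟩ := exists_seq_closure_span_eq_top H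
  have := D.isFiniteMeasure
  have := D'.isFiniteMeasure
  have key := ae_spanDim_ne_of_gram (v := fun ω i => D'.sec (x i) ω)
    (v' := fun ω i => D.sec (x i) ω) (n := n)
    (fun i j => D'.integrable_inner_sec _ _) (fun i j => D.integrable_inner_sec _ _)
    (fun g i j => by rw [D'.integral_ev_mul_inner_sec, D.integral_ev_mul_inner_sec])
    (D'.ae_exists_sec_ne_zero hx)
    (by
      filter_upwards [hD, D.ae_multiplicity_eq hx] with ω h1 h2
      rwa [← h2])
  filter_upwards [key, D'.ae_multiplicity_eq hx] with ω h1 h2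
  rwa [h2]

end UnitaryRep

/-! ### Positive functionals on commutative C⋆-algebras -/

section Gelfand

open WeakDual

/-- Under the Gelfand isomorphism a nonnegative function `f` is `star √f * √f`, so `L` is a positive
functional on continuous functions and Riesz–Markov–Kakutani applies. -/
theorem exists_measure_of_positive_functional {A : Type*} [CommCStarAlgebra A]
    [MeasurableSpace (characterSpace ℂ A)] [BorelSpace (characterSpace ℂ A)] (L : A →ₗ[ℂ] ℂ)
    (hL : ∀ a : A, 0 ≤ (L (star a * a)).re ∧ (L (star a * a)).im = 0) :
    ∃ μ : Measure (characterSpace ℂ A), IsFiniteMeasure μ ∧ ∀ a : A, ∫ χ, χ a ∂μ = L a := by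
  let Γ := gelfandStarTransform A
  let c : C(characterSpace ℂ A, ℝ) → C(characterSpace ℂ A, ℂ) := fun f =>
    ⟨fun χ => (f χ : ℂ), by fun_prop⟩
  have hpos : ∀ f : C(characterSpace ℂ A, ℝ), (∀ χ, 0 ≤ f χ) →
      0 ≤ (L (Γ.symm (c f))).re ∧ (L (Γ.symm (c f))).im = 0 := by
    intro f hf
    let s : C(characterSpace ℂ A, ℝ) := ⟨fun χ => √(f χ), by fun_prop⟩
    have hs : c f = star (c s) * c s := by
      ext χ
      simp only [c, s, ContinuousMap.mul_apply, ContinuousMap.star_apply, ContinuousMap.coe_mk,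
        RCLike.star_def, Complex.conj_ofReal]
      rw [← Complex.ofReal_mul, Real.mul_self_sqrt (hf χ)]
    rw [hs, map_mul, map_star]
    exact hL _
  have hcadd : ∀ f f', c (f + f') = c f + c f' := fun f f' => by ext χ; simp [c]
  have hcsmul : ∀ (r : ℝ) f, c (r • f) = (r : ℂ) • c f := fun r f => by ext χ; simp [c]
  -- A real function is a difference of nonnegative ones, so `L` takes real values on it.
  have him : ∀ f : C(characterSpace ℂ A, ℝ), (L (Γ.symm (c f))).im = 0 := by
    intro f
    have hf : f = f ⊔ 0 + (-1 : ℝ) • ((-f) ⊔ 0) := by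
      ext χ
      simp only [ContinuousMap.add_apply, ContinuousMap.sup_apply, ContinuousMap.zero_apply,
        ContinuousMap.smul_apply, ContinuousMap.neg_apply, smul_eq_mul]
      rcases le_total 0 (f χ) with h | h
      · rw [sup_of_le_left h, sup_of_le_right (by linarith)]; ring
      · rw [sup_of_le_right h, sup_of_le_left (by linarith)]; ring
    rw [hf, hcadd, hcsmul, map_add, map_smul, map_add, map_smul, Complex.add_im,
      (hpos (f ⊔ 0) fun χ => by simp).2, smul_eq_mul, Complex.im_ofReal_mul,
      (hpos (-f ⊔ 0) fun χ => by simp).2]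
    simp
  let Λ : CompactlySupportedContinuousMap (characterSpace ℂ A) ℝ →ₚ[ℝ] ℝ :=
    PositiveLinearMap.mk₀
      { toFun := fun f => (L (Γ.symm (c f.toContinuousMap))).re
        map_add' := fun f f' => by
          have : (f + f').toContinuousMap = f.toContinuousMap + f'.toContinuousMap := rfl
          rw [this, hcadd, map_add, map_add, Complex.add_re]
        map_smul' := fun r f => by
          have : (r • f).toContinuousMap = r • f.toContinuousMap := rfl
          rw [this, hcsmul, map_smul, map_smul, smul_eq_mul, Complex.re_ofReal_mul]
          rfl }
      fun f hf => (hpos f.toContinuousMap hf).1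
  let μ := RealRMK.rieszMeasure Λ
  have hμ : ∀ f : C(characterSpace ℂ A, ℝ), ∫ χ, (f χ : ℂ) ∂μ = L (Γ.symm (c f)) := by
    intro f
    have := RealRMK.integral_rieszMeasure Λ ⟨f, HasCompactSupport.of_compactSpace _⟩
    refine (integral_ofReal (𝕜 := ℂ)).trans (Complex.ext ?_ ?_)
    · exact this
    · rw [him]; simp
  refine ⟨μ, inferInstance, fun a => ?_⟩
  let re : C(characterSpace ℂ A, ℝ) := ⟨fun χ => (Γ a χ).re, by fun_prop⟩
  let im : C(characterSpace ℂ A, ℝ) := ⟨fun χ => (Γ a χ).im, by fun_prop⟩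
  have hdec : Γ a = c re + Complex.I • c im := by
    ext χ
    simp only [c, re, im, ContinuousMap.add_apply, ContinuousMap.smul_apply, ContinuousMap.coe_mk,
      smul_eq_mul]
    rw [mul_comm, Complex.re_add_im]
  have hint : ∀ f : C(characterSpace ℂ A, ℝ), Integrable (fun χ => (f χ : ℂ)) μ := fun f =>
    (c f).continuous.integrable_of_hasCompactSupport (HasCompactSupport.of_compactSpace _)
  calc ∫ χ, χ a ∂μ = ∫ χ, ((re χ : ℂ) + Complex.I • (im χ : ℂ)) ∂μ := by
        refine integral_congr_ae (Eventually.of_forall fun χ => ?_)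
        exact DFunLike.congr_fun hdec χ
    _ = L (Γ.symm (c re)) + Complex.I • L (Γ.symm (c im)) := by
        refine (integral_add (hint re) ((hint im).smul Complex.I)).trans ?_
        rw [hμ]
        congr 1
        exact (integral_smul Complex.I _).trans (by rw [hμ])
    _ = L a := by
        rw [← map_smul, ← map_smul, ← map_add, ← map_add, ← hdec, StarAlgEquiv.symm_apply_apply]

end Gelfand

/-! ### Spectral measures of unitary representations -/

namespace UnitaryRep

open WeakDual

section Operators

variable {G H : Type*} [Group G] [TopologicalSpace G]
  [NormedAddCommGroup H] [InnerProductSpace ℂ H]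

/-- The unitary operator `U g` as a bounded operator. -/
noncomputable def op (U : UnitaryRep G H) (g : G) : H →L[ℂ] H :=
  (U g).toContinuousLinearEquiv.toContinuousLinearMap

variable (U : UnitaryRep G H)

theorem op_apply (g : G) (x : H) : U.op g x = U g x := rfl

theorem mul_apply (g g' : G) (x : H) : U (g * g') x = U g (U g' x) := by
  rw [_root_.map_mul]; rfl

theorem one_apply (x : H) : U 1 x = x := by
  rw [_root_.map_one]; rfl

theorem apply_inv_apply (g : G) (x : H) : U g (U g⁻¹ x) = x := by
  rw [← mul_apply, mul_inv_cancel, one_apply]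

theorem inner_apply_left (g : G) (x y : H) : inner ℂ (U g x) y = inner ℂ x (U g⁻¹ y) := by
  rw [← (U g).inner_map_map x, apply_inv_apply]

theorem op_mul (g g' : G) : U.op (g * g') = U.op g * U.op g' :=
  ContinuousLinearMap.ext (U.mul_apply g g')

theorem op_one : U.op 1 = 1 :=
  ContinuousLinearMap.ext U.one_apply

theorem star_op [CompleteSpace H] (g : G) : star (U.op g) = U.op g⁻¹ := by
  rw [ContinuousLinearMap.star_eq_adjoint, eq_comm, ContinuousLinearMap.eq_adjoint_iff]
  intro x y
  rw [op_apply, op_apply, inner_apply_left, inv_inv]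

variable [MeasurableSpace G] [BorelSpace G] [SecondCountableTopology G]
  {μ : Measure G}

theorem integrable_smul_apply (f : Lp ℝ 1 μ) (x : H) :
    Integrable (fun g => f g • U g x) μ := by
  refine (L1.integrable_coeFn f).norm.mul_const ‖x‖ |>.mono' ?_ (Eventually.of_forall fun g => ?_)
  · exact (Lp.aestronglyMeasurable f).smul (U.continuous_apply x).aestronglyMeasurable
  · rw [norm_smul, LinearIsometryEquiv.norm_map]

/-- The operator `∫ f(g) U(g) dμ(g)`. -/
noncomputable def smear (f : Lp ℝ 1 μ) : H →L[ℂ] H :=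
  LinearMap.mkContinuous
    { toFun := fun x => ∫ g, f g • U g x ∂μ
      map_add' := fun x y => by
        rw [← integral_add (U.integrable_smul_apply f x) (U.integrable_smul_apply f y)]
        simp
      map_smul' := fun c x => by
        rw [RingHom.id_apply, ← integral_smul]
        simp only [_root_.map_smul, smul_comm c] }
    ‖f‖ fun x => by
      rw [L1.norm_eq_integral_norm, ← integral_mul_const]
      refine norm_integral_le_of_norm_le ((L1.integrable_coeFn f).norm.mul_const ‖x‖)
        (Eventually.of_forall fun g => ?_)
      rw [norm_smul, LinearIsometryEquiv.norm_map]

theorem smear_apply (f : Lp ℝ 1 μ) (x : H) : U.smear f x = ∫ g, f g • U g x ∂μ := rfl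

theorem norm_smear_le (f : Lp ℝ 1 μ) : ‖U.smear f‖ ≤ ‖f‖ :=
  LinearMap.mkContinuous_norm_le _ (norm_nonneg f) _

theorem smear_sub (f f' : Lp ℝ 1 μ) : U.smear (f - f') = U.smear f - U.smear f' := by
  ext x
  rw [_root_.sub_apply, smear_apply, smear_apply, smear_apply,
    ← integral_sub (U.integrable_smul_apply f x) (U.integrable_smul_apply f' x)]
  refine integral_congr_ae ?_
  filter_upwards [Lp.coeFn_sub f f'] with g hg
  rw [hg, Pi.sub_apply, sub_smul]

theorem continuous_smear : Continuous (U.smear : Lp ℝ 1 μ → H →L[ℂ] H) := by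
  refine (LipschitzWith.of_dist_le_mul (K := 1) fun f f' => ?_).continuous
  rw [dist_eq_norm, dist_eq_norm, ← smear_sub, NNReal.coe_one, one_mul]
  exact U.norm_smear_le _

variable [CompleteSpace H]

theorem commute_smear {T : H →L[ℂ] H} (hT : ∀ g, T * U.op g = U.op g * T)
    (f : Lp ℝ 1 μ) : T * U.smear f = U.smear f * T := by
  ext x
  rw [mul_apply_eq_comp, mul_apply_eq_comp, smear_apply, smear_apply,
    ← ContinuousLinearMap.integral_comp_comm _ (U.integrable_smul_apply f x)]
  refine integral_congr_ae (Eventually.of_forall fun g => ?_)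
  simp only [ContinuousLinearMap.map_smul_of_tower]
  congr 1
  exact DFunLike.congr_fun (hT g) x

/-- Multiplying by `U h` amounts to translating `f`. Since translation is continuous in `L¹`, this
turns strong continuity into norm continuity of `h ↦ U h * U.smear f`. -/
theorem op_mul_smear [IsTopologicalGroup G] [μ.IsMulLeftInvariant] (h : G) (f : Lp ℝ 1 μ) :
    U.op h * U.smear f = U.smear (DomMulAct.mk h⁻¹ • f) := by
  ext x
  rw [mul_apply_eq_comp, smear_apply, smear_apply,
    ← ContinuousLinearMap.integral_comp_comm _ (U.integrable_smul_apply f x),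
    ← integral_mul_left_eq_self _ h⁻¹]
  refine integral_congr_ae ?_
  filter_upwards [DomMulAct.smul_Lp_ae_eq (DomMulAct.mk h⁻¹) f] with g hg
  rw [hg, ContinuousLinearMap.map_smul_of_tower, op_apply, ← mul_apply, mul_inv_cancel_left]
  rfl

theorem exists_norm_smear_sub_le [LocallyCompactSpace G] [IsFiniteMeasureOnCompacts μ]
    [μ.IsOpenPosMeasure] (x : H) {ε : ℝ} (hε : 0 < ε) :
    ∃ f : Lp ℝ 1 μ, ‖U.smear f x - x‖ ≤ ε := by
  have hnhds : {g : G | ‖U g x - x‖ < ε} ∈ 𝓝 (1 : G) := by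
    refine (isOpen_lt ((U.continuous_apply x).sub continuous_const).norm
      continuous_const).mem_nhds ?_
    simpa [U.one_apply] using hε
  obtain ⟨C, hC, hCsub, hCc⟩ := local_compact_nhds hnhds
  let B := interior C
  have hB : MeasurableSet B := isOpen_interior.measurableSet
  have hBfin : μ B ≠ ∞ := ((measure_mono interior_subset).trans_lt hCc.measure_lt_top).ne
  have hBpos : 0 < μ.real B := by
    refine ENNReal.toReal_pos ?_ hBfin
    exact (isOpen_interior.measure_pos μ ⟨1, mem_interior_iff_mem_nhds.2 hC⟩).ne'
  -- The normalized indicator of a neighbourhood of `1` on which `U g x` stays `ε`-close to `x`.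
  let f : Lp ℝ 1 μ := indicatorConstLp 1 hB hBfin (μ.real B)⁻¹
  have hf : ∀ y : G → H, ∫ g, f g • y g ∂μ = (μ.real B)⁻¹ • ∫ g in B, y g ∂μ := by
    intro y
    rw [← integral_smul, ← integral_indicator hB]
    refine integral_congr_ae ?_
    filter_upwards [indicatorConstLp_coeFn (p := 1) (hs := hB) (hμs := hBfin)
      (c := (μ.real B)⁻¹)] with g hg
    rw [hg]
    by_cases hgB : g ∈ B <;> simp [hgB]
  have hint : IntegrableOn (fun g => U g x) B μ := by
    refine IntegrableOn.of_bound hBfin.lt_top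
      (U.continuous_apply x).aestronglyMeasurable ‖x‖ (Eventually.of_forall fun g => ?_)
    rw [LinearIsometryEquiv.norm_map]
  have hconst : x = (μ.real B)⁻¹ • ∫ _ in B, x ∂μ := by
    rw [setIntegral_const, inv_smul_smul₀ hBpos.ne']
  have hsub : U.smear f x - x = (μ.real B)⁻¹ • ∫ g in B, (U g x - x) ∂μ := by
    rw [smear_apply, hf, integral_sub hint (integrableOn_const hBfin), smul_sub, ← hconst]
  refine ⟨f, ?_⟩
  rw [hsub, norm_smul, norm_inv,
    Real.norm_of_nonneg hBpos.le, inv_mul_le_iff₀ hBpos, mul_comm]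
  refine norm_setIntegral_le_of_norm_le_const hBfin.lt_top fun g hg => ?_
  exact (hCsub (interior_subset hg)).le

end Operators

section Commutative

variable {G H : Type*} [CommGroup G] [TopologicalSpace G]
  [NormedAddCommGroup H] [InnerProductSpace ℂ H] [CompleteSpace H]

/-- The von Neumann algebra generated by a unitary representation. -/
noncomputable def bicommutant (U : UnitaryRep G H) : StarSubalgebra ℂ (H →L[ℂ] H) :=
  StarSubalgebra.centralizer ℂ (StarSubalgebra.centralizer ℂ (Set.range U.op) : Set (H →L[ℂ] H))

variable (U : UnitaryRep G H)

/-- The adjoint condition in the star centralizer is automatic, since the set of operators `U g` is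
closed under adjoints. -/
theorem mem_centralizer_op_iff {T : H →L[ℂ] H} :
    T ∈ StarSubalgebra.centralizer ℂ (Set.range U.op) ↔ ∀ g, T * U.op g = U.op g * T := by
  rw [StarSubalgebra.mem_centralizer_iff]
  refine ⟨fun h g => (h _ ⟨g, rfl⟩).1.symm, ?_⟩
  rintro h _ ⟨g, rfl⟩
  rw [star_op]
  exact ⟨(h g).symm, (h g⁻¹).symm⟩

theorem mem_bicommutant_iff {a : H →L[ℂ] H} :
    a ∈ U.bicommutant ↔ ∀ T : H →L[ℂ] H, (∀ g, T * U.op g = U.op g * T) → T * a = a * T := by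
  rw [bicommutant, StarSubalgebra.mem_centralizer_iff]
  constructor
  · intro h T hT
    exact (h T (U.mem_centralizer_op_iff.2 hT)).1
  · intro h T hT
    exact ⟨h T (U.mem_centralizer_op_iff.1 hT), h _ (U.mem_centralizer_op_iff.1 (star_mem hT))⟩

theorem op_mem_bicommutant (g : G) : U.op g ∈ U.bicommutant :=
  U.mem_bicommutant_iff.2 fun _ hT => hT g

/-- As `G` is commutative, every `U g` lies in the commutant. So `a` commutes with all `U g`, that
is, `a` lies in the commutant, and `b` commutes with it. -/
theorem mul_comm_of_mem_bicommutant {a b : H →L[ℂ] H} (ha : a ∈ U.bicommutant)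
    (hb : b ∈ U.bicommutant) : a * b = b * a := by
  refine U.mem_bicommutant_iff.1 hb a fun g => (U.mem_bicommutant_iff.1 ha _ fun g' => ?_).symm
  rw [← op_mul, ← op_mul, mul_comm]

instance isClosed_bicommutant : IsClosed (U.bicommutant : Set (H →L[ℂ] H)) :=
  Set.isClosed_centralizer _

noncomputable instance commCStarAlgebraBicommutant : CommCStarAlgebra U.bicommutant where
  __ := StarSubalgebra.cstarAlgebra U.bicommutant
  mul_comm a b := Subtype.ext (U.mul_comm_of_mem_bicommutant a.2 b.2)

end Commutative

end UnitaryRep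

/-! ### Bochner's theorem via characters of the generated von Neumann algebra. -/

namespace PontryaginDual

/-- A map into the dual group is measurable if its evaluations are. -/
theorem measurable_of_measurable_ev {G X : Type*} [CommGroup G]
    [TopologicalSpace G] [IsTopologicalGroup G] [LocallyCompactSpace G] [SecondCountableTopology G]
    [MeasurableSpace X]
    {f : X → PontryaginDual G} (h : ∀ g, Measurable fun x => ev g (f x)) : Measurable f := by
  let e : PontryaginDual G → ℕ → ℂ := fun ω n => ev (TopologicalSpace.denseSeq G n) ω
  -- Evaluations on a dense sequence separate characters, and an injective measurable map out of a
  -- Polish space into a countable product of lines is a measurable embedding (Lusin–Souslin).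
  have he : MeasurableEmbedding e := by
    refine Measurable.measurableEmbedding
      (measurable_pi_lambda _ fun n => (continuous_ev _).measurable) fun ω η hωη => ?_
    refine PontryaginDual.ext fun g => ?_
    refine congrFun (Continuous.ext_on (TopologicalSpace.denseRange_denseSeq G)
      (map_continuous ω) (map_continuous η) ?_) g
    rintro _ ⟨n, rfl⟩
    exact Circle.ext (congrFun hωη n)
  exact he.measurable_comp_iff.1 (measurable_pi_lambda _ fun n => h _)

end PontryaginDual

namespace UnitaryRep

open WeakDual

open PontryaginDual (ev continuous_ev)

section Bochner

variable {G H : Type*} [CommGroup G] [TopologicalSpace G]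
  [NormedAddCommGroup H] [InnerProductSpace ℂ H] [CompleteSpace H] (U : UnitaryRep G H)

/-- The operator `U g` in the von Neumann algebra generated by `U`. -/
noncomputable def opB (g : G) : U.bicommutant := ⟨U.op g, U.op_mem_bicommutant g⟩

theorem opB_mul (g g' : G) : U.opB (g * g') = U.opB g * U.opB g' := Subtype.ext (U.op_mul g g')

theorem opB_one : U.opB 1 = 1 := Subtype.ext U.op_one

theorem star_opB (g : G) : star (U.opB g) = U.opB g⁻¹ := Subtype.ext (U.star_op g)

theorem norm_character_opB (χ : characterSpace ℂ U.bicommutant) (g : G) : ‖χ (U.opB g)‖ = 1 := by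
  have h : star (χ (U.opB g)) * χ (U.opB g) = 1 := by
    rw [← map_star, ← map_mul, star_opB, ← opB_mul, inv_mul_cancel, opB_one, map_one]
  rw [← sq_eq_sq₀ (norm_nonneg _) zero_le_one, one_pow, sq, ← CStarRing.norm_star_mul_self, h,
    norm_one]

variable [MeasurableSpace G] [BorelSpace G] [SecondCountableTopology G] {μ : Measure G}

/-- The smeared operator in the von Neumann algebra generated by `U`. -/
noncomputable def smearB (f : Lp ℝ 1 μ) : U.bicommutant :=
  ⟨U.smear f, U.mem_bicommutant_iff.2 fun _ hT => U.commute_smear hT f⟩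

theorem continuous_smearB : Continuous (U.smearB : Lp ℝ 1 μ → U.bicommutant) :=
  U.continuous_smear.subtype_mk _

/-- The characters of the von Neumann algebra generated by `U` that come from the dual group. -/
def regularCharacters (μ : Measure G) : Set (characterSpace ℂ U.bicommutant) :=
  {χ | ∃ f : Lp ℝ 1 μ, χ (U.smearB f) ≠ 0}

theorem isOpen_regularCharacters (μ : Measure G) : IsOpen (U.regularCharacters μ) := by
  have : U.regularCharacters μ =
      ⋃ f : Lp ℝ 1 μ, {χ : characterSpace ℂ U.bicommutant | χ (U.smearB f) ≠ 0} := by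
    ext χ
    simp [regularCharacters]
  rw [this]
  refine isOpen_iUnion fun f => isOpen_ne_fun ?_ continuous_const
  exact (gelfandTransform ℂ U.bicommutant (U.smearB f)).continuous

variable [IsTopologicalGroup G] [LocallyCompactSpace G]

/-- Dividing `χ (U g * A)` by `χ A`, with `A` the smeared operator, exhibits the map as `χ` of a
continuously translated smearing, up to a constant. -/
theorem continuous_character_opB [μ.IsHaarMeasure] {χ : characterSpace ℂ U.bicommutant}
    {f : Lp ℝ 1 μ} (hχ : χ (U.smearB f) ≠ 0) : Continuous fun g => χ (U.opB g) := by
  have h : ∀ g, χ (U.opB g) = χ (U.smearB (DomMulAct.mk g⁻¹ • f)) / χ (U.smearB f) := by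
    intro g
    rw [eq_div_iff hχ, ← map_mul]
    congr 1
    exact Subtype.ext (U.op_mul_smear g f)
  simp only [h]
  have : Fact ((1 : ℝ≥0∞) ≠ ∞) := ⟨ENNReal.one_ne_top⟩
  refine Continuous.div_const ((map_continuous χ).comp (U.continuous_smearB.comp ?_)) _
  exact (DomMulAct.continuous_mk.comp continuous_inv).smul continuous_const

/-- The character of `G` induced by a regular character of the von Neumann algebra generated by
`U`. -/
noncomputable def characterOfRegular [μ.IsHaarMeasure] (χ : characterSpace ℂ U.bicommutant)
    (h : χ ∈ U.regularCharacters μ) : PontryaginDual G :=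
  (⟨⟨⟨fun g => ⟨χ (U.opB g), mem_sphere_zero_iff_norm.2 (U.norm_character_opB χ g)⟩,
    Subtype.ext (by change χ (U.opB 1) = 1; rw [opB_one, map_one])⟩,
    fun g g' => Subtype.ext (by
      change χ (U.opB (g * g')) = χ (U.opB g) * χ (U.opB g'); rw [opB_mul, map_mul])⟩,
    (U.continuous_character_opB h.choose_spec).subtype_mk _⟩ : G →ₜ* Circle)

open scoped Classical in
/-- The character of `G` induced by a character of the von Neumann algebra generated by `U`. -/
noncomputable def dualCharacter [μ.IsHaarMeasure] (χ : characterSpace ℂ U.bicommutant) :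
    PontryaginDual G :=
  -- The value `1` off the regular characters is arbitrary; they are shown to have full measure for
  -- the measures that get pushed forward.
  if h : χ ∈ U.regularCharacters μ then U.characterOfRegular χ h else 1

theorem ev_dualCharacter [μ.IsHaarMeasure] {χ : characterSpace ℂ U.bicommutant}
    (h : χ ∈ U.regularCharacters μ) (g : G) :
    ev g (U.dualCharacter (μ := μ) χ) = χ (U.opB g) := by
  rw [dualCharacter, dif_pos h]
  rfl

theorem measurable_dualCharacter [μ.IsHaarMeasure]
    [MeasurableSpace (characterSpace ℂ U.bicommutant)]
    [BorelSpace (characterSpace ℂ U.bicommutant)] :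
    Measurable (U.dualCharacter (μ := μ)) := by
  classical
  refine PontryaginDual.measurable_of_measurable_ev fun g => ?_
  have : (fun χ => ev g (U.dualCharacter (μ := μ) χ)) =
      fun χ => if χ ∈ U.regularCharacters μ then χ (U.opB g) else 1 := by
    ext χ
    split_ifs with h
    · exact U.ev_dualCharacter h g
    · rw [dualCharacter, dif_neg h]
      rfl
  rw [this]
  exact Measurable.ite (U.isOpen_regularCharacters μ).measurableSet
    (gelfandTransform ℂ U.bicommutant (U.opB g)).continuous.measurable measurable_const

end Bochner

/-- Bochner's theorem for matrix coefficients of unitary representations. -/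
theorem exists_spectral_measure {G H : Type*} [CommGroup G] [TopologicalSpace G]
    [IsTopologicalGroup G] [LocallyCompactSpace G] [SecondCountableTopology G]
    [NormedAddCommGroup H] [InnerProductSpace ℂ H] [CompleteSpace H] (U : UnitaryRep G H)
    (x : H) : ∃ ν : Measure (PontryaginDual G), IsFiniteMeasure ν ∧
      ∀ g, ∫ ω, ev g ω ∂ν = inner ℂ x (U g x) := by
  let _ : MeasurableSpace G := borel G
  have : BorelSpace G := ⟨rfl⟩
  let μ : Measure G := Measure.haar
  let _ : MeasurableSpace (characterSpace ℂ U.bicommutant) := borel _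
  have : BorelSpace (characterSpace ℂ U.bicommutant) := ⟨rfl⟩
  let L : U.bicommutant →ₗ[ℂ] ℂ :=
    { toFun := fun a => inner ℂ x ((a : H →L[ℂ] H) x)
      map_add' := fun a b => inner_add_right _ _ _
      map_smul' := fun c a => inner_smul_right _ _ _ }
  have hL : ∀ a : U.bicommutant, L (star a * a) = (‖(a : H →L[ℂ] H) x‖ ^ 2 : ℝ) := by
    intro a
    change inner ℂ x ((star (a : H →L[ℂ] H) * (a : H →L[ℂ] H)) x) = _
    rw [mul_apply_eq_comp, ContinuousLinearMap.star_eq_adjoint,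
      ContinuousLinearMap.adjoint_inner_right, inner_self_eq_norm_sq_to_K]
    simp
  obtain ⟨m, hm, hint⟩ := exists_measure_of_positive_functional L fun a => by
    rw [hL]
    exact ⟨by rw [Complex.ofReal_re]; positivity, Complex.ofReal_im _⟩
  have hX : MeasurableSet (U.regularCharacters μ) := (U.isOpen_regularCharacters μ).measurableSet
  have hreal : ∀ a : U.bicommutant, ∫ χ, ‖χ a‖ ^ 2 ∂m = ‖(a : H →L[ℂ] H) x‖ ^ 2 := by
    intro a
    have h := hint (star a * a)
    rw [hL] at h
    have h2 : ∀ χ : characterSpace ℂ U.bicommutant, χ (star a * a) = ((‖χ a‖ ^ 2 : ℝ) : ℂ) := by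
      intro χ
      rw [map_mul, map_star, RCLike.star_def, Complex.conj_mul']
      simp
    simp only [h2] at h
    exact Complex.ofReal_injective ((integral_ofReal (𝕜 := ℂ)).symm.trans h)
  have hcont : ∀ a : U.bicommutant, Continuous fun χ : characterSpace ℂ U.bicommutant => χ a :=
    fun a => (gelfandTransform ℂ U.bicommutant a).continuous
  -- At an irregular `χ` one has `χ (U.smearB f) = 0`, so `‖χ (U.smearB f - 1)‖ = 1`. Hence the
  -- measure of the irregular set is at most `‖U.smear f x - x‖ ^ 2`, which can be made arbitrarily
  -- small.
  have hnull : m (U.regularCharacters μ)ᶜ = 0 := by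
    have hle : ∀ ε : ℝ, 0 < ε → m.real (U.regularCharacters μ)ᶜ ≤ ε ^ 2 := by
      intro ε hε
      obtain ⟨f, hf⟩ := U.exists_norm_smear_sub_le (μ := μ) x hε
      have h1 : ∫ χ in (U.regularCharacters μ)ᶜ, ‖χ (U.smearB f - 1)‖ ^ 2 ∂m =
          m.real (U.regularCharacters μ)ᶜ := by
        rw [← setIntegral_one_eq_measureReal]
        refine setIntegral_congr_fun hX.compl fun χ hχ => ?_
        have : χ (U.smearB f) = 0 := by
          by_contra hc
          exact hχ ⟨f, hc⟩
        simp [map_sub, this]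
      rw [← h1]
      refine (setIntegral_le_integral ?_ (Eventually.of_forall fun χ => by positivity)).trans ?_
      · exact ((hcont _).norm.pow 2).integrable_of_hasCompactSupport
          (HasCompactSupport.of_compactSpace _)
      · rw [hreal]
        exact pow_le_pow_left₀ (norm_nonneg _) hf 2
    have h0 : m.real (U.regularCharacters μ)ᶜ ≤ 0 := by
      refine le_of_forall_pos_le_add fun ε hε => ?_
      have := hle (√ε) (Real.sqrt_pos.2 hε)
      rwa [Real.sq_sqrt hε.le, ← zero_add ε] at this
    exact (measureReal_eq_zero_iff).1 (le_antisymm h0 measureReal_nonneg)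
  refine ⟨m.map (U.dualCharacter (μ := μ)), inferInstance, fun g => ?_⟩
  rw [integral_map U.measurable_dualCharacter.aemeasurable
    (continuous_ev g).aestronglyMeasurable]
  have h : ∀ᵐ χ ∂m, χ ∈ U.regularCharacters μ := by
    rw [ae_iff]
    exact hnull
  calc _ = ∫ χ, χ (U.opB g) ∂m := by
        refine integral_congr_ae ?_
        filter_upwards [h] with χ hχ
        exact U.ev_dualCharacter hχ g
    _ = _ := hint _

end UnitaryRep

/-! ### Existence of spectral decompositions -/

namespace UnitaryRep

open PontryaginDual (ev)

section Cyclic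

variable {G H : Type*} [Group G] [TopologicalSpace G]
  [NormedAddCommGroup H] [InnerProductSpace ℂ H] (U : UnitaryRep G H)

/-- The closed invariant subspace generated by a set of vectors. -/
noncomputable def cyclicSpan (S : Set H) : Submodule ℂ H :=
  (Submodule.span ℂ (Set.image2 (fun (g : G) x => U g x) Set.univ S)).topologicalClosure

theorem apply_mem_cyclicSpan {S : Set H} {x : H} (hx : x ∈ S) (g : G) :
    U g x ∈ U.cyclicSpan S :=
  Submodule.le_topologicalClosure _ (Submodule.subset_span ⟨g, trivial, x, hx, rfl⟩)

theorem mem_cyclicSpan {S : Set H} {x : H} (hx : x ∈ S) : x ∈ U.cyclicSpan S := by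
  simpa only [one_apply] using U.apply_mem_cyclicSpan hx 1

/-- A closed subspace that contains an orbit-closed set of vectors contains its cyclic span. -/
theorem cyclicSpan_le {S : Set H} {M : Submodule ℂ H} (hM : IsClosed (M : Set H))
    (h : ∀ x ∈ S, ∀ g, U g x ∈ M) : U.cyclicSpan S ≤ M := by
  refine Submodule.topologicalClosure_minimal _ ?_ hM
  rw [Submodule.span_le]
  rintro _ ⟨g, -, x, hx, rfl⟩
  exact h x hx g

theorem isClosed_cyclicSpan (S : Set H) : IsClosed (U.cyclicSpan S : Set H) :=
  Submodule.isClosed_topologicalClosure _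

theorem map_mem_cyclicSpan {S : Set H} {x : H} (hx : x ∈ U.cyclicSpan S) (g : G) :
    U g x ∈ U.cyclicSpan S := by
  have h : U.cyclicSpan S ≤ (U.cyclicSpan S).comap (U g).toLinearEquiv.toLinearMap := by
    refine U.cyclicSpan_le ((U.isClosed_cyclicSpan S).preimage (U g).continuous) ?_
    intro y hy g'
    change U g (U g' y) ∈ U.cyclicSpan S
    rw [← mul_apply]
    exact U.apply_mem_cyclicSpan hy _
  exact h hx

theorem cyclicSpan_mono {S T : Set H} (h : S ⊆ T) : U.cyclicSpan S ≤ U.cyclicSpan T :=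
  U.cyclicSpan_le (U.isClosed_cyclicSpan T) fun _ hx g => U.apply_mem_cyclicSpan (h hx) g

/-- Gram–Schmidt with cyclic subspaces: from `x n` one subtracts its projection onto the closed
invariant subspace generated by the earlier `x k`. The norm bound makes the sum of the spectral
measures finite. -/
theorem exists_orthogonal_cyclic_vectors [CompleteSpace H] [TopologicalSpace.SeparableSpace H] :
    ∃ φ : ℕ → H, (∀ n m, n ≠ m → ∀ g, inner ℂ (φ n) (U g (φ m)) = 0) ∧
      (∀ y, (∀ n g, inner ℂ (U g (φ n)) y = 0) → y = 0) ∧ ∀ n, ‖φ n‖ ^ 2 ≤ (1 / 2) ^ n := by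
  obtain ⟨x, hx⟩ := exists_seq_closure_span_eq_top H
  let Z : ℕ → Submodule ℂ H := fun n => U.cyclicSpan (x '' Set.Iio n)
  have hZc : ∀ n, CompleteSpace (Z n) := fun n =>
    (U.isClosed_cyclicSpan _).completeSpace_coe
  let ψ : ℕ → H := fun n => x n - (Z n).starProjection (x n)
  have hψ : ∀ n, ψ n ∈ (Z n)ᗮ := fun n => Submodule.sub_starProjection_mem_orthogonal _
  have hψZ : ∀ {k n}, k < n → ψ k ∈ Z n := by
    intro k n hk
    refine Submodule.sub_mem _ (U.mem_cyclicSpan ⟨k, hk, rfl⟩) ?_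
    exact U.cyclicSpan_mono (Set.image_mono (Set.Iio_subset_Iio hk.le))
      (Submodule.starProjection_apply_mem _ _)
  have horth : ∀ {k n}, k < n → ∀ g, inner ℂ (U g (ψ k)) (ψ n) = 0 := fun hk g =>
    (Submodule.mem_orthogonal _ _).1 (hψ _) _ (U.map_mem_cyclicSpan (hψZ hk) g)
  have htot : ∀ y, (∀ n g, inner ℂ (U g (ψ n)) y = 0) → y = 0 := by
    intro y hy
    have key : ∀ n g, inner ℂ (U g (x n)) y = 0 := by
      intro n
      induction n using Nat.strong_induction_on with
      | _ n ih =>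
        intro g
        have hZy : Z n ≤ (ℂ ∙ y)ᗮ := by
          refine U.cyclicSpan_le (Submodule.isClosed_orthogonal _) ?_
          rintro _ ⟨k, hk, rfl⟩ g'
          rw [Submodule.mem_orthogonal_singleton_iff_inner_left]
          exact ih k hk g'
        have h1 := hZy (U.map_mem_cyclicSpan
          (Submodule.starProjection_apply_mem (Z n) (x n)) g)
        rw [Submodule.mem_orthogonal_singleton_iff_inner_left] at h1
        have h2 : x n = ψ n + (Z n).starProjection (x n) := by simp [ψ]
        rw [h2, map_add, inner_add_left, hy, h1, add_zero]
    have h3 : y ∈ (Submodule.span ℂ (Set.range x))ᗮ := by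
      have : Submodule.span ℂ (Set.range x) ≤ (ℂ ∙ y)ᗮ := by
        rw [Submodule.span_le]
        rintro _ ⟨n, rfl⟩
        have := key n 1
        rw [one_apply] at this
        exact Submodule.mem_orthogonal_singleton_iff_inner_left.2 this
      exact (Submodule.mem_orthogonal _ _).2 fun u hu =>
        Submodule.mem_orthogonal_singleton_iff_inner_left.1 (this hu)
    rw [Submodule.topologicalClosure_eq_top_iff] at hx
    rwa [hx, Submodule.mem_bot] at h3
  -- The factor `(1 / 2) ^ n` gives summability; `1 + ‖ψ n‖` avoids dividing by zero when `ψ n = 0`.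
  let c : ℕ → ℝ := fun n => (1 / 2) ^ n * (1 + ‖ψ n‖)⁻¹
  have hc : ∀ n, 0 < c n := fun n => by positivity
  have hinner : ∀ n m g, inner ℂ (U g (c n • ψ n)) (c m • ψ m) =
      (c n * c m : ℝ) * inner ℂ (U g (ψ n)) (ψ m) := by
    intro n m g
    rw [← Complex.coe_smul, ← Complex.coe_smul, map_smul, inner_smul_left, inner_smul_right]
    simp [mul_assoc]
  refine ⟨fun n => c n • ψ n, fun n m hnm g => ?_, fun y hy => htot y fun n g => ?_, fun n => ?_⟩
  · rw [← inv_inv g, ← inner_apply_left, hinner]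
    rcases lt_or_gt_of_ne hnm with h | h
    · rw [horth h, mul_zero]
    · rw [inner_apply_left, ← inner_conj_symm, horth h, map_zero, mul_zero]
  · have := hy n g
    beta_reduce at this
    rw [← Complex.coe_smul, map_smul, inner_smul_left, mul_eq_zero] at this
    refine this.resolve_left ?_
    simpa using (hc n).ne'
  · have h1 : ‖c n • ψ n‖ ≤ (1 / 2) ^ n := by
      rw [norm_smul, Real.norm_of_nonneg (hc n).le, mul_assoc]
      refine mul_le_of_le_one_right (by positivity) ?_
      rw [inv_mul_le_iff₀ (by positivity)]
      linarith
    have h2 : ‖c n • ψ n‖ ≤ 1 := h1.trans (pow_le_one₀ (by norm_num) (by norm_num))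
    nlinarith [norm_nonneg (c n • ψ n)]

end Cyclic

end UnitaryRep

theorem MeasureTheory.isFiniteMeasure_sum_of_real_le {Ω : Type*} [MeasurableSpace Ω]
    {ν : ℕ → Measure Ω} [∀ n, IsFiniteMeasure (ν n)]
    (h : ∀ n, (ν n).real Set.univ ≤ (1 / 2) ^ n) : IsFiniteMeasure (Measure.sum ν) := by
  refine ⟨?_⟩
  rw [Measure.sum_apply _ MeasurableSet.univ]
  calc ∑' n, ν n Set.univ ≤ ∑' n, ENNReal.ofReal ((1 / 2) ^ n) := by
        refine ENNReal.tsum_le_tsum fun n => ?_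
        rw [← ENNReal.ofReal_toReal (measure_ne_top (ν n) Set.univ)]
        exact ENNReal.ofReal_le_ofReal (h n)
    _ = ENNReal.ofReal (∑' n, (1 / 2) ^ n) :=
        (ENNReal.ofReal_tsum_of_nonneg (fun n => by positivity) summable_geometric_two).symm
    _ < ∞ := ENNReal.ofReal_lt_top

namespace MeasurableHilbertField

variable {Ω : Type*} [MeasurableSpace Ω]

/-- The field whose fiber over `ω` is spanned by those standard basis vectors `e n` for which
`h n ω ≠ 0`. -/
noncomputable def ofWeights (h : ℕ → Ω → ℝ) (hh : ∀ n, Measurable (h n)) :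
    MeasurableHilbertField Ω where
  fiber ω := (Submodule.span ℂ (Set.range fun n =>
    (h n ω : ℂ) • (lp.single 2 n (1 : ℂ) : ℓ²(ℕ, ℂ)))).topologicalClosure
  exists_sections := ⟨fun n ω => (h n ω : ℂ) • (lp.single 2 n (1 : ℂ) : ℓ²(ℕ, ℂ)),
    fun n => (Complex.measurable_ofReal.comp (hh n)).stronglyMeasurable.smul_const _,
    fun _ => rfl⟩

theorem inner_basis (n m : ℕ) : inner ℂ (lp.single 2 n (1 : ℂ) : ℓ²(ℕ, ℂ)) (lp.single 2 m (1 : ℂ)) =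
    if n = m then 1 else 0 := by
  rw [lp.inner_single_left]
  by_cases h : n = m
  · subst h; simp
  · simp [h]

theorem norm_basis (n : ℕ) : ‖(lp.single 2 n (1 : ℂ) : ℓ²(ℕ, ℂ))‖ = 1 := by
  rw [lp.norm_single (by norm_num)]
  simp

theorem ofWeights_ne_bot {h : ℕ → Ω → ℝ} {hh : ∀ n, Measurable (h n)} {ω : Ω} {n : ℕ}
    (hn : h n ω ≠ 0) : (ofWeights h hh).fiber ω ≠ ⊥ := by
  intro hbot
  have : (h n ω : ℂ) • (lp.single 2 n (1 : ℂ) : ℓ²(ℕ, ℂ)) ∈ (ofWeights h hh).fiber ω :=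
    Submodule.le_topologicalClosure _ (Submodule.subset_span ⟨n, rfl⟩)
  rw [hbot, Submodule.mem_bot, ← norm_eq_zero, norm_smul, norm_basis] at this
  simp [hn] at this

theorem eq_zero_of_mem_ofWeights {h : ℕ → Ω → ℝ} {hh : ∀ n, Measurable (h n)} {ω : Ω}
    {f : ℓ²(ℕ, ℂ)} (hf : f ∈ (ofWeights h hh).fiber ω)
    (h0 : ∀ n, inner ℂ ((h n ω : ℂ) • (lp.single 2 n (1 : ℂ) : ℓ²(ℕ, ℂ))) f = 0) : f = 0 := by
  have hle : (ofWeights h hh).fiber ω ≤ (ℂ ∙ f)ᗮ := by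
    refine Submodule.topologicalClosure_minimal _ ?_ (Submodule.isClosed_orthogonal _)
    rw [Submodule.span_le]
    rintro _ ⟨n, rfl⟩
    exact Submodule.mem_orthogonal_singleton_iff_inner_left.2 (h0 n)
  have := Submodule.mem_orthogonal_singleton_iff_inner_left.1 (hle hf)
  rwa [inner_self_eq_zero] at this

/-- The relation `T A = c T` between an operator `A` and the multiplication by a function `c` can be
checked on a total family of vectors. -/
theorem ae_eq_smul_of_total {F : MeasurableHilbertField Ω} {σ : Measure Ω} {ι H : Type*}
    [NormedAddCommGroup H] [InnerProductSpace ℂ H] (T : H ≃ₗᵢ[ℂ] F.directIntegral σ)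
    (A : H ≃ₗᵢ[ℂ] H) {c : Ω → ℂ} {v : ι → H}
    (hv : (Submodule.span ℂ (Set.range v)).topologicalClosure = ⊤)
    (h : ∀ i, (T (A (v i)) : Lp ℓ²(ℕ, ℂ) 2 σ) =ᵐ[σ] fun ω => c ω • (T (v i) : Lp ℓ²(ℕ, ℂ) 2 σ) ω)
    (x : H) :
    (T (A x) : Lp ℓ²(ℕ, ℂ) 2 σ) =ᵐ[σ] fun ω => c ω • (T x : Lp ℓ²(ℕ, ℂ) 2 σ) ω := by
  let S : H →ₗ[ℂ] Lp ℓ²(ℕ, ℂ) 2 σ :=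
    (F.directIntegral σ).subtype.comp T.toLinearEquiv.toLinearMap
  have hS : Continuous S := continuous_subtype_val.comp T.continuous
  change ∀ i, S (A (v i)) =ᵐ[σ] fun ω => c ω • S (v i) ω at h
  change S (A x) =ᵐ[σ] fun ω => c ω • S x ω
  have hspan : ∀ x ∈ Submodule.span ℂ (Set.range v), S (A x) =ᵐ[σ] fun ω => c ω • S x ω := by
    intro x hx
    induction hx using Submodule.span_induction with
    | mem x hx =>
      obtain ⟨i, rfl⟩ := hx
      exact h i
    | zero =>
      rw [map_zero, map_zero]
      filter_upwards [Lp.coeFn_zero ℓ²(ℕ, ℂ) 2 σ] with ω h1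
      rw [h1, Pi.zero_apply, smul_zero]
    | add x y _ _ hx hy =>
      rw [map_add, map_add, map_add]
      filter_upwards [hx, hy, Lp.coeFn_add (S (A x)) (S (A y)),
        Lp.coeFn_add (S x) (S y)] with ω h1 h2 h3 h4
      rw [h3, h4, Pi.add_apply, Pi.add_apply, h1, h2, smul_add]
    | smul a x _ hx =>
      rw [map_smul, map_smul, map_smul]
      filter_upwards [hx, Lp.coeFn_smul a (S (A x)), Lp.coeFn_smul a (S x)] with ω h1 h2 h3
      rw [h2, h3, Pi.smul_apply, Pi.smul_apply, h1, smul_comm]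
  have hxcl : x ∈ closure (Submodule.span ℂ (Set.range v) : Set H) := by
    rw [← Submodule.topologicalClosure_coe, hv]
    trivial
  obtain ⟨u, hu, hlim⟩ := mem_closure_iff_seq_limit.1 hxcl
  obtain ⟨ns, hns, h1⟩ := ae_exists_subseq_tendsto ((hS.tendsto x).comp hlim)
  obtain ⟨ms, hms, h2⟩ := ae_exists_subseq_tendsto
    (((hS.comp A.continuous).tendsto x).comp (hlim.comp hns.tendsto_atTop))
  filter_upwards [h1, h2, ae_all_iff.2 fun k => hspan _ (hu k)] with ω h3 h4 h5
  refine tendsto_nhds_unique h4 ?_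
  simp only [Function.comp_apply, h5]
  exact (h3.comp hms.tendsto_atTop).const_smul (c ω)

end MeasurableHilbertField

namespace UnitaryRep

open PontryaginDual (ev continuous_ev norm_ev ev_mul ev_inv)

open MeasurableHilbertField

/-- Every strongly continuous unitary representation of a locally compact second countable Abelian
group on a separable Hilbert space has a spectral decomposition. -/
theorem nonempty_spectralDecomposition {G H : Type*} [CommGroup G] [TopologicalSpace G]
    [IsTopologicalGroup G] [LocallyCompactSpace G] [SecondCountableTopology G]
    [NormedAddCommGroup H] [InnerProductSpace ℂ H] [CompleteSpace H]
    [TopologicalSpace.SeparableSpace H] (U : UnitaryRep G H) :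
    Nonempty U.SpectralDecomposition := by
  obtain ⟨φ, horth, htot, hnorm⟩ := U.exists_orthogonal_cyclic_vectors
  choose ν hν hνint using fun n => U.exists_spectral_measure (φ n)
  have hνuniv : ∀ n, (ν n).real Set.univ = ‖φ n‖ ^ 2 := by
    intro n
    have h := hνint n 1
    rw [one_apply, inner_self_eq_norm_sq_to_K] at h
    have h1 : ∀ ω : PontryaginDual G, ev 1 ω = ((1 : ℝ) : ℂ) := fun ω => by
      rw [PontryaginDual.ev_one, Complex.ofReal_one]
    simp only [h1] at h
    have h2 := (integral_ofReal (𝕜 := ℂ) (μ := ν n) (f := fun _ => (1 : ℝ))).symm.trans h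
    rw [integral_const, smul_eq_mul, mul_one] at h2
    exact_mod_cast h2
  let σ := Measure.sum ν
  have hσ : IsFiniteMeasure σ := isFiniteMeasure_sum_of_real_le fun n => (hνuniv n).trans_le (hnorm n)
  have hac : ∀ n, ν n ≪ σ := fun n => (Measure.le_sum ν n).absolutelyContinuous
  -- The square root of the density of `ν n`: the vector `φ n` is to become the section `h n • e n`,
  -- whose squared norm is that density.
  let h : ℕ → PontryaginDual G → ℝ := fun n ω => √((ν n).rnDeriv σ ω).toReal
  have hh : ∀ n, Measurable (h n) := fun n =>
    ((Measure.measurable_rnDeriv (ν n) σ).ennreal_toReal).sqrt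
  have hsq : ∀ n ω, h n ω * h n ω = ((ν n).rnDeriv σ ω).toReal := fun n ω =>
    Real.mul_self_sqrt ENNReal.toReal_nonneg
  have hL2 : ∀ n, MemLp (h n) 2 σ := fun n => by
    rw [memLp_two_iff_integrable_sq (hh n).aestronglyMeasurable]
    simp only [sq, hsq]
    exact Measure.integrable_toReal_rnDeriv
  have hint : ∀ n g, ∫ ω, ev g ω * ((h n ω : ℂ) * (h n ω : ℂ)) ∂σ = inner ℂ (φ n) (U g (φ n)) := by
    intro n g
    rw [← hνint n g, ← integral_rnDeriv_smul (hac n)]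
    refine integral_congr_ae (Eventually.of_forall fun ω => ?_)
    simp only [Complex.real_smul]
    rw [← hsq, Complex.ofReal_mul, mul_comm]
  let F := ofWeights h hh
  let b : ℕ → ℓ²(ℕ, ℂ) := fun n => lp.single 2 n (1 : ℂ)
  have hmem : ∀ p : ℕ × G, MemLp (fun ω => ev p.2 ω • (h p.1 ω : ℂ) • b p.1) 2 σ := by
    intro p
    refine (hL2 p.1).mono ?_ (Eventually.of_forall fun ω => ?_)
    · exact (continuous_ev p.2).aestronglyMeasurable.smul
        ((Complex.measurable_ofReal.comp (hh p.1)).stronglyMeasurable.smul_const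
          (b p.1)).aestronglyMeasurable
    · rw [norm_smul, norm_smul, norm_ev, norm_basis, one_mul, mul_one, Complex.norm_real]
  have hmemF : ∀ p, (hmem p).toLp ∈ F.directIntegral σ := by
    intro p
    change ∀ᵐ ω ∂σ, _
    filter_upwards [(hmem p).coeFn_toLp] with ω hω
    rw [hω]
    exact Submodule.smul_mem _ _
      (Submodule.le_topologicalClosure _ (Submodule.subset_span ⟨p.1, rfl⟩))
  let W : ℕ × G → Lp ℓ²(ℕ, ℂ) 2 σ := fun p => (hmem p).toLp
  have hW : ∀ p, W p =ᵐ[σ] fun ω => ev p.2 ω • (h p.1 ω : ℂ) • b p.1 := fun p =>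
    (hmem p).coeFn_toLp
  let w : ℕ × G → F.directIntegral σ := fun p => ⟨W p, hmemF p⟩
  let v : ℕ × G → H := fun p => U p.2 (φ p.1)
  have hcomplete : CompleteSpace (F.directIntegral σ) :=
    (F.isClosed_directIntegral σ).completeSpace_coe
  have hgram : ∀ p q, inner ℂ (v p) (v q) = inner ℂ (w p) (w q) := by
    rintro ⟨n, g⟩ ⟨m, g'⟩
    have h1 : inner ℂ (w (n, g)) (w (m, g')) =
        ∫ ω, ev (g⁻¹ * g') ω * ((h n ω : ℂ) * (h m ω : ℂ)) * (if n = m then 1 else 0) ∂σ := by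
      rw [Submodule.coe_inner, L2.inner_def]
      refine integral_congr_ae ?_
      filter_upwards [hW (n, g), hW (m, g')] with ω h2 h3
      change inner ℂ (W (n, g) ω) (W (m, g') ω) = _
      rw [h2, h3, inner_smul_left, inner_smul_left, inner_smul_right, inner_smul_right,
        inner_basis, ev_mul, ev_inv, Complex.conj_ofReal, RCLike.star_def]
      ring
    rw [h1]
    change inner ℂ (U g (φ n)) (U g' (φ m)) = _
    rw [inner_apply_left, ← mul_apply]
    by_cases hnm : n = m
    · subst hnm
      simp only [if_true, mul_one]
      rw [hint]
    · rw [horth n m hnm]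
      simp [hnm]
  have hv : (Submodule.span ℂ (Set.range v)).topologicalClosure = ⊤ := by
    rw [Submodule.topologicalClosure_eq_top_iff, eq_bot_iff]
    intro y hy
    refine htot y fun n g => (Submodule.mem_orthogonal _ _).1 hy _ (Submodule.subset_span ⟨(n, g), rfl⟩)
  have hw : (Submodule.span ℂ (Set.range w)).topologicalClosure = ⊤ := by
    rw [Submodule.topologicalClosure_eq_top_iff, eq_bot_iff]
    intro f hf
    -- Orthogonality of `f` to all `w (n, g)` says that the Fourier transform of `⟪h n • e n, f⟫`
    -- vanishes.
    have hzero : ∀ n, ∀ᵐ ω ∂σ, inner ℂ ((h n ω : ℂ) • b n) ((f : Lp ℓ²(ℕ, ℂ) 2 σ) ω) = 0 := by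
      intro n
      have hi : Integrable (fun ω => inner ℂ ((h n ω : ℂ) • b n) ((f : Lp ℓ²(ℕ, ℂ) 2 σ) ω)) σ := by
        refine (L2.integrable_inner (𝕜 := ℂ) (W (n, 1)) (f : Lp ℓ²(ℕ, ℂ) 2 σ)).congr ?_
        filter_upwards [hW (n, 1)] with ω h2
        rw [h2, PontryaginDual.ev_one, one_smul]
      refine PontryaginDual.ae_eq_zero_of_forall_integral_eval_mul hi fun g => ?_
      rw [← (Submodule.mem_orthogonal _ _).1 hf _ (Submodule.subset_span ⟨(n, g⁻¹), rfl⟩),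
        Submodule.coe_inner, L2.inner_def]
      refine integral_congr_ae ?_
      filter_upwards [hW (n, g⁻¹)] with ω h2
      change _ = inner ℂ (W (n, g⁻¹) ω) _
      rw [h2, inner_smul_left _ _ (ev g⁻¹ ω), ev_inv, RCLike.star_def, Complex.conj_conj]
    rw [Submodule.mem_bot, ← Submodule.coe_eq_zero, Lp.eq_zero_iff_ae_eq_zero]
    filter_upwards [ae_all_iff.2 hzero, f.2] with ω h1 h2
    exact eq_zero_of_mem_ofWeights h2 h1
  obtain ⟨T, hT⟩ := exists_linearIsometryEquiv_of_gram hgram hv hw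
  refine ⟨⟨σ, hσ, F, ?_, T, fun g x => ?_⟩⟩
  -- The density of `ν n` is positive `ν n`-almost everywhere and `σ` is the sum of the `ν n`, so
  -- almost every point has some nonzero weight.
  · have hpos : ∀ n, ∀ᵐ ω ∂(ν n), h n ω ≠ 0 := by
      intro n
      filter_upwards [Measure.rnDeriv_pos (hac n),
        (hac n).ae_le (Measure.rnDeriv_lt_top (ν n) σ)] with ω h1 h2
      exact (Real.sqrt_pos.2 (ENNReal.toReal_pos h1.ne' h2.ne)).ne'
    rw [Measure.ae_sum_iff]
    intro n
    filter_upwards [hpos n] with ω hω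
    exact ofWeights_ne_bot hω
  · refine ae_eq_smul_of_total T (U g) hv ?_ x
    rintro ⟨n, g'⟩
    have h1 : U g (v (n, g')) = v (n, g * g') := (U.mul_apply g g' (φ n)).symm
    rw [h1, hT, hT]
    filter_upwards [hW (n, g'), hW (n, g * g')] with ω h2 h3
    change W (n, g * g') ω = ev g ω • W (n, g') ω
    rw [h2, h3, ev_mul, mul_smul]

end UnitaryRep

/-! ### Hilbert space tensor products -/

namespace HilbertTensor

variable {H K : Type*} [NormedAddCommGroup H] [InnerProductSpace ℂ H]
  [NormedAddCommGroup K] [InnerProductSpace ℂ K]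

/-- The elementary tensors as a bilinear map into the completed tensor product. -/
noncomputable def tmul : H →ₗ[ℂ] K →ₗ[ℂ] HilbertTensor H K :=
  (TensorProduct.mk ℂ H K).compr₂
    (UniformSpace.Completion.toComplₗᵢ (𝕜 := ℂ) (E := H ⊗[ℂ] K)).toLinearMap

theorem tmul_eq_coe (x : H) (y : K) :
    tmul x y = ((x ⊗ₜ[ℂ] y : H ⊗[ℂ] K) : HilbertTensor H K) := rfl

theorem continuous_tmul : Continuous fun p : H × K => tmul p.1 p.2 := by
  have h : Continuous fun p : H × K => p.1 ⊗ₜ[ℂ] p.2 := (TensorProduct.mkL ℂ H K).continuous₂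
  exact (UniformSpace.Completion.continuous_coe _).comp h

theorem inner_tmul (x x' : H) (y y' : K) :
    inner ℂ (tmul x y) (tmul x' y') = inner ℂ x x' * inner ℂ y y' := by
  rw [tmul_eq_coe, tmul_eq_coe, UniformSpace.Completion.inner_coe, TensorProduct.inner_tmul]

theorem eq_top_of_tmul_mem {M : Submodule ℂ (HilbertTensor H K)}
    (hM : IsClosed (M : Set (HilbertTensor H K))) (h : ∀ x y, tmul x y ∈ M) : M = ⊤ := by
  refine Submodule.eq_top_iff'.2 fun z => ?_
  induction z using UniformSpace.Completion.induction_on with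
  | hp => exact hM
  | ih a =>
    induction a with
    | zero => exact M.zero_mem
    | tmul x y => exact h x y
    | add a b ha hb =>
      rw [UniformSpace.Completion.coe_add]
      exact M.add_mem ha hb

theorem closure_span_tmul_eq_top {ι κ : Type*} {x : ι → H} {y : κ → K}
    (hx : (Submodule.span ℂ (Set.range x)).topologicalClosure = ⊤)
    (hy : (Submodule.span ℂ (Set.range y)).topologicalClosure = ⊤) :
    (Submodule.span ℂ
      (Set.range fun p : ι × κ => tmul (x p.1) (y p.2))).topologicalClosure = ⊤ := by
  set M := (Submodule.span ℂ
      (Set.range fun p : ι × κ => tmul (x p.1) (y p.2))).topologicalClosure with hMdef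
  have hM : IsClosed (M : Set (HilbertTensor H K)) := Submodule.isClosed_topologicalClosure _
  have hgen : ∀ i j, tmul (x i) (y j) ∈ M := fun i j =>
    Submodule.le_topologicalClosure _ (Submodule.subset_span ⟨(i, j), rfl⟩)
  have h1 : ∀ i b, tmul (x i) b ∈ M := by
    intro i
    have hle : (Submodule.span ℂ (Set.range y)).topologicalClosure ≤ M.comap (tmul (x i)) := by
      refine Submodule.topologicalClosure_minimal _ ?_
        (hM.preimage (continuous_tmul.comp (Continuous.prodMk_right (x i))))
      rw [Submodule.span_le]
      rintro _ ⟨j, rfl⟩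
      exact hgen i j
    rw [hy] at hle
    exact fun b => hle trivial
  refine eq_top_of_tmul_mem hM fun a b => ?_
  have hle : (Submodule.span ℂ (Set.range x)).topologicalClosure ≤
      M.comap ((tmul (H := H) (K := K)).flip b) := by
    refine Submodule.topologicalClosure_minimal _ ?_
      (hM.preimage (continuous_tmul.comp (Continuous.prodMk_left b)))
    rw [Submodule.span_le]
    rintro _ ⟨i, rfl⟩
    exact h1 i b
  rw [hx] at hle
  exact hle trivial

theorem separableSpace [TopologicalSpace.SeparableSpace H] [TopologicalSpace.SeparableSpace K] :
    TopologicalSpace.SeparableSpace (HilbertTensor H K) := by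
  obtain ⟨x, hx⟩ := UnitaryRep.exists_seq_closure_span_eq_top H
  obtain ⟨y, hy⟩ := UnitaryRep.exists_seq_closure_span_eq_top K
  have h := closure_span_tmul_eq_top hx hy
  have hsep : TopologicalSpace.IsSeparable ((Submodule.span ℂ
      (Set.range fun p : ℕ × ℕ => tmul (x p.1) (y p.2))).topologicalClosure :
        Set (HilbertTensor H K)) := by
    rw [Submodule.topologicalClosure_coe]
    exact ((Set.countable_range _).isSeparable.span (R := ℂ)).closure
  rw [h] at hsep
  exact TopologicalSpace.isSeparable_univ_iff.1 hsep

end HilbertTensor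

/-- The dimension of the span of a family of elementary tensors. -/
theorem spanDim_tmul {ι κ E E' : Type*} [AddCommGroup E] [Module ℂ E] [AddCommGroup E']
    [Module ℂ E'] (a : ι → E) (b : κ → E') :
    spanDim (fun p : ι × κ => a p.1 ⊗ₜ[ℂ] b p.2) = spanDim a * spanDim b := by
  have hspan : Submodule.span ℂ (Set.range fun p : ι × κ => a p.1 ⊗ₜ[ℂ] b p.2) =
      LinearMap.range (TensorProduct.mapIncl (Submodule.span ℂ (Set.range a))
        (Submodule.span ℂ (Set.range b))) := by
    rw [TensorProduct.range_mapIncl, Submodule.map₂_span_span]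
    congr 1
    ext z
    simp [Set.mem_image2]
  -- Vector spaces are flat, so the tensor product of the two spans embeds in the ambient tensor
  -- product.
  have hinj : Function.Injective (TensorProduct.mapIncl (Submodule.span ℂ (Set.range a))
      (Submodule.span ℂ (Set.range b))) :=
    TensorProduct.map_injective_of_flat_flat _ _ (Submodule.injective_subtype _)
      (Submodule.injective_subtype _)
  rw [spanDim, hspan, ← (LinearEquiv.ofInjective _ hinj).rank_eq, rank_tensorProduct, map_mul,
    Cardinal.toENat_lift, Cardinal.toENat_lift]
  rfl

/-! ### Invariant subspaces and cyclic vectors of a tensor product. -/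

namespace UnitaryRep

section Invariant

variable {G H : Type*} [Group G] [TopologicalSpace G]
  [NormedAddCommGroup H] [InnerProductSpace ℂ H] (U : UnitaryRep G H)

theorem cyclicSpan_singleton (x : H) : U.cyclicSpan {x} =
    (Submodule.span ℂ (Set.range fun g : G => U g x)).topologicalClosure := by
  rw [cyclicSpan, Set.image2_singleton_right, Set.image_univ]

/-- Invariance under `g` and under `g⁻¹` are carried together so that the induction passes through
inverses. -/
theorem apply_mem_of_mem_closure {M : Submodule ℂ H} {s : Set G}
    (h : ∀ g ∈ s, ∀ z ∈ M, U g z ∈ M) (h' : ∀ g ∈ s, ∀ z ∈ M, U g⁻¹ z ∈ M) {g : G}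
    (hg : g ∈ Subgroup.closure s) : (∀ z ∈ M, U g z ∈ M) ∧ ∀ z ∈ M, U g⁻¹ z ∈ M := by
  induction hg using Subgroup.closure_induction with
  | mem g hg => exact ⟨h g hg, h' g hg⟩
  | one =>
    rw [inv_one, and_self]
    intro z hz
    rwa [one_apply]
  | mul a b _ _ ha hb =>
    refine ⟨fun z hz => ?_, fun z hz => ?_⟩
    · rw [mul_apply]
      exact ha.1 _ (hb.1 z hz)
    · rw [mul_inv_rev, mul_apply]
      exact hb.2 _ (ha.2 z hz)
  | inv a _ ha => exact ⟨ha.2, by simpa only [inv_inv] using ha.1⟩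

/-- Invariance of a closed subspace can be checked on topological generators. -/
theorem apply_mem_of_dense_closure {M : Submodule ℂ H} (hM : IsClosed (M : Set H)) {s : Set G}
    (hs : Dense (Subgroup.closure s : Set G))
    (h : ∀ g ∈ s, ∀ z ∈ M, U g z ∈ M) (h' : ∀ g ∈ s, ∀ z ∈ M, U g⁻¹ z ∈ M) (g : G) {z : H}
    (hz : z ∈ M) : U g z ∈ M := by
  have hcl : IsClosed {g | U g z ∈ M} := hM.preimage (U.continuous_apply z)
  exact hcl.closure_subset_iff.2
    (fun g hg => (U.apply_mem_of_mem_closure h h' hg).1 z hz) (hs g)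

end Invariant

section Tensor

open HilbertTensor (tmul continuous_tmul)

variable {G H K : Type*} [NormedAddCommGroup H] [InnerProductSpace ℂ H]
  [NormedAddCommGroup K] [InnerProductSpace ℂ K]

theorem tensor_apply_tmul [Group G] [TopologicalSpace G] (U : UnitaryRep G H) (V : UnitaryRep G K)
    (g : G) (x : H) (y : K) : U.tensor V g (tmul x y) = tmul (U g x) (V g y) := by
  rw [HilbertTensor.tmul_eq_coe]
  exact LinearIsometryEquiv.toCompletion_coe _ _

/-- The trivial representation. -/
def trivial (G H : Type*) [Group G] [TopologicalSpace G] [NormedAddCommGroup H]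
    [InnerProductSpace ℂ H] : UnitaryRep G H where
  toHom := 1
  continuous_apply _ := continuous_const

theorem trivial_tensor_apply_tmul [Group G] [TopologicalSpace G] (V : UnitaryRep G K) (g : G)
    (x : H) (y : K) : (trivial G H).tensor V g (tmul x y) = tmul x (V g y) :=
  tensor_apply_tmul _ _ _ _ _

/-- Strong convergence of unitary operators can be checked on a total set. -/
theorem tendsto_of_forall_tmul {α : Type*} {l : Filter α}
    {T : α → HilbertTensor H K ≃ₗᵢ[ℂ] HilbertTensor H K}
    {S : HilbertTensor H K ≃ₗᵢ[ℂ] HilbertTensor H K}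
    (h : ∀ x y, Tendsto (fun k => T k (tmul x y)) l (𝓝 (S (tmul x y)))) (z : HilbertTensor H K) :
    Tendsto (fun k => T k z) l (𝓝 (S z)) := by
  let M : Submodule ℂ (HilbertTensor H K) :=
    { carrier := {z | Tendsto (fun k => T k z) l (𝓝 (S z))}
      add_mem' := fun {a b} ha hb => by
        change Tendsto (fun k => T k (a + b)) l (𝓝 (S (a + b)))
        simp only [map_add]
        exact ha.add hb
      zero_mem' := by
        change Tendsto (fun k => T k 0) l (𝓝 (S 0))
        simp only [map_zero]
        exact tendsto_const_nhds
      smul_mem' := fun c a ha => by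
        change Tendsto (fun k => T k (c • a)) l (𝓝 (S (c • a)))
        simp only [map_smul]
        exact ha.const_smul c }
  have hM : IsClosed (M : Set (HilbertTensor H K)) := by
    refine isClosed_of_closure_subset fun z hz => ?_
    change Tendsto (fun k => T k z) l (𝓝 (S z))
    rw [Metric.tendsto_nhds]
    intro ε hε
    obtain ⟨w, hw, hzw⟩ := Metric.mem_closure_iff.1 hz (ε / 3) (by positivity)
    filter_upwards [Metric.tendsto_nhds.1 hw (ε / 3) (by positivity)] with k hk
    calc dist (T k z) (S z) ≤ dist (T k z) (T k w) + dist (T k w) (S w) + dist (S w) (S z) :=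
          dist_triangle4 _ _ _ _
      _ < ε := by
          rw [LinearIsometryEquiv.dist_map, LinearIsometryEquiv.dist_map, dist_comm w z]
          linarith
  have := HilbertTensor.eq_top_of_tmul_mem hM h
  exact (this ▸ Submodule.mem_top : z ∈ M)

/-- Applying the isometry `U (g k * d)` turns the distance between the two inverse images into the
distance between `U d x` and `U (g k) x`. -/
theorem tendsto_inv_apply [CommGroup G] [TopologicalSpace G] {α : Type*} {l : Filter α}
    (U : UnitaryRep G H) {g : α → G} {d : G} {x : H}
    (h : Tendsto (fun k => U (g k) x) l (𝓝 (U d x))) :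
    Tendsto (fun k => U (g k)⁻¹ x) l (𝓝 (U d⁻¹ x)) := by
  rw [tendsto_iff_dist_tendsto_zero] at h ⊢
  refine h.congr fun k => ?_
  rw [← (U (g k * d)).dist_map (U (g k)⁻¹ x), ← mul_apply, ← mul_apply, mul_inv_cancel_right,
    mul_comm (g k) d, mul_inv_cancel_right, dist_comm]

/-- If `U (g k) → 1` and `V (g k) → V d` strongly, then every closed subspace that is invariant
under `U ⊗ V` is invariant under `1 ⊗ V d`. -/
theorem trivial_tensor_apply_mem [CommGroup G] [TopologicalSpace G] (U : UnitaryRep G H)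
    (V : UnitaryRep G K) {g : ℕ → G} {d : G}
    (hU : ∀ x : H, Tendsto (fun k => U (g k) x) atTop (𝓝 x))
    (hV : ∀ y : K, Tendsto (fun k => V (g k) y) atTop (𝓝 (V d y)))
    {M : Submodule ℂ (HilbertTensor H K)} (hM : IsClosed (M : Set (HilbertTensor H K)))
    (hinv : ∀ g, ∀ z ∈ M, U.tensor V g z ∈ M) {z : HilbertTensor H K} (hz : z ∈ M) :
    (trivial G H).tensor V d z ∈ M := by
  have h : ∀ x y, Tendsto (fun k => U.tensor V (g k) (tmul x y)) atTop
      (𝓝 ((trivial G H).tensor V d (tmul x y))) := by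
    intro x y
    have h1 := (continuous_tmul.tendsto (x, V d y)).comp ((hU x).prodMk_nhds (hV y))
    rw [trivial_tensor_apply_tmul]
    exact h1.congr fun k => (tensor_apply_tmul U V (g k) x y).symm
  have h2 : Tendsto (fun k => U.tensor V (g k) z) atTop (𝓝 ((trivial G H).tensor V d z)) :=
    tendsto_of_forall_tmul (T := fun k => U.tensor V (g k)) (S := (trivial G H).tensor V d) h z
  exact hM.mem_of_tendsto h2 (Eventually.of_forall fun k => hinv (g k) z hz)

theorem isCyclic_tensor [CommGroup G] [TopologicalSpace G] {J : Type*} (U : UnitaryRep G H)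
    (V : UnitaryRep G K) (g : ℕ → G) (n : J → ℕ → ℕ) (hn : ∀ i, StrictMono (n i)) (d : J → G)
    (hU : ∀ x : H, Tendsto (fun k => U (g k) x) atTop (𝓝 x))
    (hV : ∀ (i : J) (y : K), Tendsto (fun k => V (g (n i k)) y) atTop (𝓝 (V (d i) y)))
    (hd : Dense (Subgroup.closure (Set.range d) : Set G))
    {φ : H} {ψ : K} (hφ : U.IsCyclic φ) (hψ : V.IsCyclic ψ) :
    (U.tensor V).IsCyclic (tmul φ ψ) := by
  rw [IsCyclic, ← cyclicSpan_singleton]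
  have hM := (U.tensor V).isClosed_cyclicSpan {tmul φ ψ}
  have hinv : ∀ h, ∀ z ∈ (U.tensor V).cyclicSpan {tmul φ ψ},
      U.tensor V h z ∈ (U.tensor V).cyclicSpan {tmul φ ψ} := fun h z hz =>
    (U.tensor V).map_mem_cyclicSpan hz h
  have horbit : ∀ a, tmul (U a φ) (V a ψ) ∈ (U.tensor V).cyclicSpan {tmul φ ψ} := by
    intro a
    rw [← tensor_apply_tmul]
    exact (U.tensor V).apply_mem_cyclicSpan (Set.mem_singleton _) a
  -- Only closedness, invariance and the orbit of `tmul φ ψ` matter from here on.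
  generalize (U.tensor V).cyclicSpan {tmul φ ψ} = M at hM hinv horbit
  have hR : ∀ h, ∀ z ∈ M, (trivial G H).tensor V h z ∈ M := by
    intro h z hz
    have hUi : ∀ i, ∀ x : H, Tendsto (fun k => U (g (n i k)) x) atTop (𝓝 x) := fun i x =>
      (hU x).comp (hn i).tendsto_atTop
    refine ((trivial G H).tensor V).apply_mem_of_dense_closure hM hd ?_ ?_ h hz
    · rintro _ ⟨i, rfl⟩ z hz
      exact U.trivial_tensor_apply_mem V (hUi i) (hV i) hM hinv hz
    · rintro _ ⟨i, rfl⟩ z hz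
      refine U.trivial_tensor_apply_mem V (g := fun k => (g (n i k))⁻¹) (fun x => ?_)
        (fun y => V.tendsto_inv_apply (hV i y)) hM hinv hz
      have := U.tendsto_inv_apply (d := 1) (x := x) (by simpa only [one_apply] using hUi i x)
      simpa only [inv_one, one_apply] using this
  have h1 : ∀ a b, tmul (U a φ) (V b ψ) ∈ M := by
    intro a b
    -- Applying `1 ⊗ V (b * a⁻¹)` to `U a φ ⊗ V a ψ` decouples the two group elements.
    have h2 := hR (b * a⁻¹) _ (horbit a)
    rw [trivial_tensor_apply_tmul, ← mul_apply, inv_mul_cancel_right] at h2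
    exact h2
  refine eq_top_iff.2 ?_
  rw [← HilbertTensor.closure_span_tmul_eq_top hφ hψ]
  refine Submodule.topologicalClosure_minimal _ ?_ hM
  rw [Submodule.span_le]
  rintro _ ⟨⟨a, b⟩, rfl⟩
  exact h1 a b

end Tensor

end UnitaryRep

/-! ### The spectral type and multiplicity of a tensor product -/

namespace MeasurableHilbertField

variable {Ω : Type*} [MeasurableSpace Ω]

/-- The first nonzero vector among the first `n` members of a sequence, and zero if there is
none. -/
noncomputable def firstNonzero {E : Type*} [Zero E] (s : ℕ → Ω → E) : ℕ → Ω → E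
  | 0 => 0
  | n + 1 => by
    classical
    exact fun ω => if firstNonzero s n ω ≠ 0 then firstNonzero s n ω else s n ω

/-- A measurable field of Hilbert spaces has a measurable section that vanishes only where the
fiber does. -/
theorem exists_nonvanishing_section (F : MeasurableHilbertField Ω) :
    ∃ t : Ω → ℓ²(ℕ, ℂ), StronglyMeasurable t ∧ ∀ ω, t ω ∈ F.fiber ω ∧
      (F.fiber ω ≠ ⊥ → t ω ≠ 0) := by
  classical
  obtain ⟨s, hsm, hs⟩ := F.exists_sections
  let u := firstNonzero s
  have hsucc : ∀ n ω, u (n + 1) ω = if u n ω ≠ 0 then u n ω else s n ω := fun n ω => by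
    simp only [u, firstNonzero]
    congr
  have hmeas : ∀ n, StronglyMeasurable (u n) := by
    intro n
    induction n with
    | zero => exact stronglyMeasurable_zero
    | succ n ih =>
      have : u (n + 1) = fun ω => if u n ω ≠ 0 then u n ω else s n ω := funext (hsucc n)
      rw [this]
      exact StronglyMeasurable.ite ih.measurableSet_support ih (hsm n)
  have hmem : ∀ n ω, u n ω ∈ F.fiber ω := by
    intro n ω
    induction n with
    | zero => exact (F.fiber ω).zero_mem
    | succ n ih =>
      rw [hsucc]
      split_ifs
      · exact ih
      · rw [← hs ω]
        exact Submodule.le_topologicalClosure _ (Submodule.subset_span ⟨n, rfl⟩)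
  have hstable : ∀ {n ω}, u n ω ≠ 0 → ∀ m, n ≤ m → u m ω = u n ω := by
    intro n ω h0 m hm
    induction m, hm using Nat.le_induction with
    | base => rfl
    | succ m _ ih => rw [hsucc, ih, if_pos h0]
  -- Each sequence `u n ω` is eventually constant, so its pointwise limit is measurable and is zero
  -- only if all terms are.
  have hlim : ∀ ω, ∃ a, Tendsto (fun n => u n ω) atTop (𝓝 a) ∧ (a = 0 → ∀ n, u n ω = 0) := by
    intro ω
    by_cases h : ∃ n, u n ω ≠ 0
    · obtain ⟨n, hn⟩ := h
      refine ⟨u n ω, tendsto_const_nhds.congr' ?_, fun h0 => absurd h0 hn⟩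
      filter_upwards [eventually_ge_atTop n] with m hm
      exact (hstable hn m hm).symm
    · push Not at h
      exact ⟨0, by simp only [h]; exact tendsto_const_nhds, fun _ => h⟩
  choose t ht ht0 using hlim
  refine ⟨t, stronglyMeasurable_of_tendsto atTop hmeas (tendsto_pi_nhds.2 ht), fun ω =>
    ⟨(F.isClosed_fiber ω).mem_of_tendsto (ht ω) (Eventually.of_forall fun n => hmem n ω),
      fun hne h0 => hne ?_⟩⟩
  rw [← hs ω, eq_bot_iff]
  refine Submodule.topologicalClosure_minimal _ ?_ (by simp)
  rw [Submodule.span_le]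
  rintro _ ⟨n, rfl⟩
  have h1 := hsucc n ω
  rw [ht0 ω h0, ht0 ω h0, if_neg (by simp)] at h1
  exact h1.symm

end MeasurableHilbertField

namespace UnitaryRep

open PontryaginDual (ev)

open HilbertTensor (tmul)

variable {G H K : Type*} [CommGroup G] [TopologicalSpace G]
  [NormedAddCommGroup H] [InnerProductSpace ℂ H] [NormedAddCommGroup K] [InnerProductSpace ℂ K]

namespace SpectralDecomposition

/-- Such a vector allows the scalar `ev g ω` to be recovered from the sections of `x` and `U g x` by
division, turning strong convergence of operators into convergence of characters. -/
theorem exists_sec_ne_zero {U : UnitaryRep G H} (D : U.SpectralDecomposition) :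
    ∃ x : H, ∀ᵐ ω ∂D.σ, D.sec x ω ≠ 0 := by
  have := D.isFiniteMeasure
  obtain ⟨t, htm, ht⟩ := D.field.exists_nonvanishing_section
  have hpos : ∀ ω, (0 : ℝ) < 1 + ‖t ω‖ := fun ω => by positivity
  have hmem : MemLp (fun ω => ((1 + ‖t ω‖)⁻¹ : ℝ) • t ω) 2 D.σ := by
    refine MemLp.of_bound (C := 1) (StronglyMeasurable.aestronglyMeasurable ?_)
      (Eventually.of_forall fun ω => ?_)
    · exact ((htm.norm.measurable.const_add 1).inv.stronglyMeasurable).smul htm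
    · rw [norm_smul, norm_inv, Real.norm_of_nonneg (hpos ω).le, inv_mul_le_iff₀ (hpos ω)]
      linarith
  have hF : hmem.toLp ∈ D.field.directIntegral D.σ := by
    change ∀ᵐ ω ∂D.σ, _
    filter_upwards [hmem.coeFn_toLp] with ω hω
    rw [hω]
    exact Submodule.smul_of_tower_mem _ _ (ht ω).1
  refine ⟨D.iso.symm ⟨hmem.toLp, hF⟩, ?_⟩
  filter_upwards [hmem.coeFn_toLp, D.fiber_ne_bot] with ω h1 h2
  rw [sec, LinearIsometryEquiv.apply_symm_apply, h1]
  exact smul_ne_zero (inv_ne_zero (hpos ω).ne') ((ht ω).2 h2)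

/-- Strong convergence `U (g k) → U d` implies that, along a subsequence, `ω (g k) → ω d` for
almost every `ω`. -/
theorem exists_subseq_tendsto_ev {U : UnitaryRep G H} (D : U.SpectralDecomposition) {g : ℕ → G}
    {d : G} (h : ∀ x, Tendsto (fun k => U (g k) x) atTop (𝓝 (U d x))) :
    ∃ ns : ℕ → ℕ, StrictMono ns ∧
      ∀ᵐ ω ∂D.σ, Tendsto (fun k => ev (g (ns k)) ω) atTop (𝓝 (ev d ω)) := by
  obtain ⟨x, hx⟩ := D.exists_sec_ne_zero
  obtain ⟨ns, hns, hlim⟩ := MeasurableHilbertField.ae_exists_subseq_tendsto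
    (((continuous_subtype_val.comp D.iso.continuous).tendsto _).comp (h x))
  refine ⟨ns, hns, ?_⟩
  filter_upwards [hx, hlim, D.sec_apply d x, ae_all_iff.2 fun k => D.sec_apply (g k) x]
    with ω h1 h2 h3 h4
  change Tendsto (fun k => D.sec (U (g (ns k)) x) ω) atTop (𝓝 (D.sec (U d x) ω)) at h2
  simp only [h3, h4] at h2
  have h5 := (h2.inner (tendsto_const_nhds (x := D.sec x ω))).div_const
    (inner ℂ (D.sec x ω) (D.sec x ω))
  have h6 : inner ℂ (D.sec x ω) (D.sec x ω) ≠ 0 := inner_self_eq_zero.not.2 h1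
  simp only [inner_smul_left, mul_div_assoc, div_self h6, mul_one] at h5
  simpa using h5.star

end SpectralDecomposition

/-- Almost every pair of characters can be recovered measurably from its product. -/
theorem exists_measurable_left_inverse_mul [IsTopologicalGroup G] [LocallyCompactSpace G]
    [SecondCountableTopology G] {J : Type*} [Countable J]
    {σ τ : Measure (PontryaginDual G)} [SFinite σ] [SFinite τ] (g : J → ℕ → G) (d : J → G)
    (hσ : ∀ᵐ ω ∂σ, ∀ i, Tendsto (fun k => ev (g i k) ω) atTop (𝓝 1))
    (hτ : ∀ᵐ η ∂τ, ∀ i, Tendsto (fun k => ev (g i k) η) atTop (𝓝 (ev (d i) η)))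
    (hd : Dense (Subgroup.closure (Set.range d) : Set G)) :
    ∃ c : PontryaginDual G → PontryaginDual G × PontryaginDual G, Measurable c ∧
      ∀ᵐ p ∂σ.prod τ, c (p.1 * p.2) = p := by
  obtain ⟨A, hA, hAm, hAlim⟩ := hσ.exists_measurable_mem
  obtain ⟨B, hB, hBm, hBlim⟩ := hτ.exists_measurable_mem
  let m : A ×ˢ B → PontryaginDual G := fun p => p.1.1 * p.1.2
  have hm : Measurable m := (measurable_fst.mul measurable_snd).comp measurable_subtype_coe
  have : StandardBorelSpace (A ×ˢ B : Set (PontryaginDual G × PontryaginDual G)) :=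
    (hAm.prod hBm).standardBorel
  have hinj : Function.Injective m := by
    rintro ⟨⟨ω, η⟩, hω, hη⟩ ⟨⟨ω', η'⟩, hω', hη'⟩ h
    change ω * η = ω' * η' at h
    -- The limit sees only the product `ω * η` on one side and only `η` on the other, so the product
    -- determines `η (d i)`.
    have hlim : ∀ {ω η : PontryaginDual G}, ω ∈ A → η ∈ B → ∀ i,
        Tendsto (fun k => ev (g i k) (ω * η)) atTop (𝓝 (ev (d i) η)) := by
      intro ω η hω hη i
      simpa only [one_mul, PontryaginDual.ev_mul_apply] using
        (hAlim ω hω i).mul (hBlim η hη i)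
    have hgen : ∀ i, η (d i) = η' (d i) := fun i => Circle.ext <|
      tendsto_nhds_unique (hlim hω hη i) (h ▸ hlim hω' hη' i)
    have hηη' : η = η' := by
      refine PontryaginDual.ext fun a => ?_
      refine congrFun (Continuous.ext_on hd (map_continuous η) (map_continuous η') ?_) a
      intro b hb
      refine Subgroup.closure_induction (fun b hb => ?_) ?_ (fun a b _ _ ha hb => ?_)
        (fun a _ ha => ?_) hb
      · obtain ⟨i, rfl⟩ := hb
        exact hgen i
      · rw [map_one, map_one]
      · rw [map_mul, map_mul, ha, hb]
      · rw [map_inv, map_inv, ha]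
    subst hηη'
    obtain rfl := mul_right_cancel h
    rfl
  -- By Lusin–Souslin the injective map `m` is a measurable embedding; its inverse is extended
  -- measurably beyond the range.
  obtain ⟨c, hc, hcm⟩ := (hm.measurableEmbedding hinj).exists_measurable_extend
    measurable_subtype_coe fun _ => ⟨1⟩
  refine ⟨c, hc, ?_⟩
  have h1 : ∀ᵐ p ∂σ.prod τ, p.1 ∈ A := Measure.quasiMeasurePreserving_fst.ae hA
  have h2 : ∀ᵐ p ∂σ.prod τ, p.2 ∈ B := Measure.quasiMeasurePreserving_snd.ae hB
  filter_upwards [h1, h2] with p hp1 hp2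
  exact congrFun hcm ⟨p, hp1, hp2⟩

/-- Since `ℕ∞ × ℕ∞` is countable, the level set of the product is a countable union of rectangles,
and a rectangle is null exactly when one of its sides is. The product formula for rectangles needs
no measurability of `a` and `b`. -/
theorem not_ae_mul_ne_iff {Ω Ω' : Type*} [MeasurableSpace Ω] [MeasurableSpace Ω']
    {σ : Measure Ω} {τ : Measure Ω'} [SFinite σ] [SFinite τ] (a : Ω → ℕ∞) (b : Ω' → ℕ∞) (n : ℕ∞) :
    (¬ ∀ᵐ p ∂σ.prod τ, a p.1 * b p.2 ≠ n) ↔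
      ∃ k, (¬ ∀ᵐ ω ∂σ, a ω ≠ k) ∧ ∃ l, (¬ ∀ᵐ ω ∂τ, b ω ≠ l) ∧ k * l = n := by
  constructor
  · contrapose!
    intro h
    have key : ∀ q : ℕ∞ × ℕ∞, ∀ᵐ p ∂σ.prod τ, q.1 * q.2 = n → ¬ (a p.1 = q.1 ∧ b p.2 = q.2) := by
      intro q
      by_cases hq : q.1 * q.2 = n
      · by_cases h1 : ∀ᵐ ω ∂σ, a ω ≠ q.1
        · filter_upwards [Measure.quasiMeasurePreserving_fst.ae h1] with p hp _ h2
          exact hp h2.1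
        · have h2 : ∀ᵐ ω ∂τ, b ω ≠ q.2 := by
            by_contra hc
            exact h q.1 h1 q.2 hc hq
          filter_upwards [Measure.quasiMeasurePreserving_snd.ae h2] with p hp _ h3
          exact hp h3.2
      · exact Eventually.of_forall fun p h1 => absurd h1 hq
    filter_upwards [ae_all_iff.2 key] with p hp h1
    exact hp (a p.1, b p.2) h1 ⟨rfl, rfl⟩
  · rintro ⟨k, hk, l, hl, rfl⟩ h
    have h0 : σ.prod τ ({ω | a ω = k} ×ˢ {ω | b ω = l}) = 0 := by
      refine measure_mono_null ?_ (ae_iff.1 h)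
      rintro ⟨ω, η⟩ ⟨h1, h2⟩
      change a ω = k at h1
      change b η = l at h2
      simp [h1, h2]
    rw [Measure.prod_prod, mul_eq_zero] at h0
    rcases h0 with h0 | h0
    · exact hk (ae_iff.2 (by simpa using h0))
    · exact hl (ae_iff.2 (by simpa using h0))

end UnitaryRep

namespace UnitaryRep

open PontryaginDual (ev continuous_ev ev_mul_apply)

open HilbertTensor (tmul)

section

variable {G H K : Type*} [CommGroup G] [TopologicalSpace G] [IsTopologicalGroup G]
  [LocallyCompactSpace G] [SecondCountableTopology G]
  [NormedAddCommGroup H] [InnerProductSpace ℂ H] [TopologicalSpace.SeparableSpace H]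
  [NormedAddCommGroup K] [InnerProductSpace ℂ K] [TopologicalSpace.SeparableSpace K]
  {U : UnitaryRep G H} {V : UnitaryRep G K}

/-- If almost every pair of characters can be recovered measurably from its product, then the
multiplicity of `U ⊗ V` at `ω * η` is the product of the multiplicities of `U` at `ω` and of `V`
at `η`. -/
theorem ae_multiplicity_tensor_ne_iff (DU : U.SpectralDecomposition) (DV : V.SpectralDecomposition)
    (D : (U.tensor V).SpectralDecomposition)
    {c : PontryaginDual G → PontryaginDual G × PontryaginDual G} (hc : Measurable c)
    (hcm : ∀ᵐ p ∂DU.σ.prod DV.σ, c (p.1 * p.2) = p) (n : ℕ∞) :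
    (∀ᵐ ω ∂D.σ, D.multiplicity ω ≠ n) ↔
      ∀ᵐ p ∂DU.σ.prod DV.σ, DU.multiplicity p.1 * DV.multiplicity p.2 ≠ n := by
  have := DU.isFiniteMeasure
  have := DV.isFiniteMeasure
  have := D.isFiniteMeasure
  obtain ⟨x, hx⟩ := exists_seq_closure_span_eq_top H
  obtain ⟨y, hy⟩ := exists_seq_closure_span_eq_top K
  have hxy := HilbertTensor.closure_span_tmul_eq_top hx hy
  set τ := DU.σ.prod DV.σ with hτ
  let m : PontryaginDual G × PontryaginDual G → PontryaginDual G := fun p => p.1 * p.2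
  have hm : Measurable m := measurable_fst.mul measurable_snd
  have hmq : Measure.QuasiMeasurePreserving m τ (τ.map m) := ⟨hm, Measure.AbsolutelyContinuous.rfl⟩
  -- Since `c` inverts `m` almost everywhere, it carries the pushforward of `τ` back to `τ`;
  -- statements about pairs thus become statements about the dual group.
  have hcp : MeasurePreserving c (τ.map m) τ := by
    refine ⟨hc, ?_⟩
    rw [Measure.map_map hc hm, Measure.map_congr (show c ∘ m =ᵐ[τ] id from hcm), Measure.map_id]
  have hae : ∀ P : PontryaginDual G × PontryaginDual G → Prop,
      (∀ᵐ θ ∂(τ.map m), P (c θ)) ↔ ∀ᵐ p ∂τ, P p := by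
    refine fun P => ⟨fun h => ?_, fun h => hcp.quasiMeasurePreserving.ae h⟩
    filter_upwards [hmq.ae h, hcm] with p h1 h2
    rwa [← h2]
  -- The composite `v ∘ c` plays the part of the sections of `tmul (x i) (y j)` over the pushforward
  -- measure; only its Gram matrix is used, so no decomposition of `U ⊗ V` has to be built from it.
  let v : PontryaginDual G × PontryaginDual G → ℕ × ℕ → ℓ²(ℕ, ℂ) ⊗[ℂ] ℓ²(ℕ, ℂ) := fun p i =>
    DU.sec (x i.1) p.1 ⊗ₜ[ℂ] DV.sec (y i.2) p.2
  have hvinner : ∀ p i j, inner ℂ (v p i) (v p j) =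
      inner ℂ (DU.sec (x i.1) p.1) (DU.sec (x j.1) p.1) *
        inner ℂ (DV.sec (y i.2) p.2) (DV.sec (y j.2) p.2) := fun p i j =>
    TensorProduct.inner_tmul ..
  have hvint : ∀ i j, Integrable (fun p => inner ℂ (v p i) (v p j)) τ := by
    intro i j
    simp only [hvinner]
    exact (DU.integrable_inner_sec _ _).mul_prod (DV.integrable_inner_sec _ _)
  have hvint' : ∀ i j, Integrable (fun θ => inner ℂ (v (c θ) i) (v (c θ) j)) (τ.map m) :=
    fun i j => hcp.integrable_comp_of_integrable (hvint i j)
  have hFourier : ∀ g i j, ∫ θ, ev g θ * inner ℂ (v (c θ) i) (v (c θ) j) ∂(τ.map m) =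
      inner ℂ (tmul (x i.1) (y i.2)) (U.tensor V g (tmul (x j.1) (y j.2))) := by
    intro g i j
    have hmeas : AEStronglyMeasurable (fun θ => ev g θ * inner ℂ (v (c θ) i) (v (c θ) j))
        (τ.map m) :=
      (continuous_ev g).aestronglyMeasurable.mul (hvint' i j).aestronglyMeasurable
    rw [integral_map hm.aemeasurable hmeas,
      tensor_apply_tmul, HilbertTensor.inner_tmul, ← DU.integral_ev_mul_inner_sec,
      ← DV.integral_ev_mul_inner_sec, ← integral_prod_mul]
    refine integral_congr_ae ?_
    filter_upwards [hcm] with p hp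
    rw [hp, hvinner, ev_mul_apply]
    ring
  have hne : ∀ᵐ θ ∂(τ.map m), ∃ i, v (c θ) i ≠ 0 := by
    refine (hae fun p => ∃ i, v p i ≠ 0).2 ?_
    filter_upwards [Measure.quasiMeasurePreserving_fst.ae (DU.ae_exists_sec_ne_zero hx),
      Measure.quasiMeasurePreserving_snd.ae (DV.ae_exists_sec_ne_zero hy)] with p h1 h2
    obtain ⟨i, hi⟩ := h1
    obtain ⟨j, hj⟩ := h2
    refine ⟨(i, j), ?_⟩
    rw [← norm_ne_zero_iff, TensorProduct.norm_tmul]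
    exact mul_ne_zero (norm_ne_zero_iff.2 hi) (norm_ne_zero_iff.2 hj)
  have hD : (∀ᵐ ω ∂D.σ, D.multiplicity ω ≠ n) ↔
      ∀ᵐ ω ∂D.σ, spanDim (fun i : ℕ × ℕ => D.sec (tmul (x i.1) (y i.2)) ω) ≠ n := by
    refine eventually_congr ?_
    filter_upwards [D.ae_multiplicity_eq hxy] with ω h1
    rw [h1]
  have hτdim : (∀ᵐ p ∂τ, DU.multiplicity p.1 * DV.multiplicity p.2 ≠ n) ↔
      ∀ᵐ p ∂τ, spanDim (v p) ≠ n := by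
    refine eventually_congr ?_
    filter_upwards [Measure.quasiMeasurePreserving_fst.ae (DU.ae_multiplicity_eq hx),
      Measure.quasiMeasurePreserving_snd.ae (DV.ae_multiplicity_eq hy)] with p h1 h2
    rw [h1, h2, ← spanDim_tmul]
  rw [hD, hτdim, ← hae fun p => spanDim (v p) ≠ n]
  have hgram : ∀ g (i j : ℕ × ℕ), ∫ ω, ev g ω * inner ℂ (D.sec (tmul (x i.1) (y i.2)) ω)
      (D.sec (tmul (x j.1) (y j.2)) ω) ∂D.σ =
        ∫ θ, ev g θ * inner ℂ (v (c θ) i) (v (c θ) j) ∂(τ.map m) := fun g i j => by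
    rw [hFourier, D.integral_ev_mul_inner_sec]
  -- The comparison is applied in both directions; each needs nonvanishing vectors only on its
  -- target side.
  exact ⟨ae_spanDim_ne_of_gram hvint' (fun i j => D.integrable_inner_sec _ _)
      (fun g i j => (hgram g i j).symm) hne,
    ae_spanDim_ne_of_gram (fun i j => D.integrable_inner_sec _ _) hvint' hgram
      (D.ae_exists_sec_ne_zero hxy)⟩

theorem essMultiplicities_tensor [CompleteSpace H] [CompleteSpace K] {J : Type*} [Countable J]
    (g : ℕ → G) (n : J → ℕ → ℕ) (hn : ∀ i, StrictMono (n i)) (d : J → G)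
    (hU : ∀ x : H, Tendsto (fun k => U (g k) x) atTop (𝓝 x))
    (hV : ∀ (i : J) (y : K), Tendsto (fun k => V (g (n i k)) y) atTop (𝓝 (V (d i) y)))
    (hd : Dense (Subgroup.closure (Set.range d) : Set G)) :
    (U.tensor V).essMultiplicities = U.essMultiplicities * V.essMultiplicities := by
  obtain ⟨DU⟩ := U.nonempty_spectralDecomposition
  obtain ⟨DV⟩ := V.nonempty_spectralDecomposition
  have := HilbertTensor.separableSpace (H := H) (K := K)
  obtain ⟨D⟩ := (U.tensor V).nonempty_spectralDecomposition
  have := DU.isFiniteMeasure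
  have := DV.isFiniteMeasure
  have hsub : ∀ i, ∃ ns : ℕ → ℕ,
      (∀ᵐ ω ∂DU.σ, Tendsto (fun k => ev (g (n i (ns k))) ω) atTop (𝓝 1)) ∧
        ∀ᵐ η ∂DV.σ, Tendsto (fun k => ev (g (n i (ns k))) η) atTop (𝓝 (ev (d i) η)) := by
    intro i
    -- Two successive extractions for each `i`: one for the characters of `U`, then a further one
    -- for those of `V`, which preserves the first limit.
    obtain ⟨ns, hns, h1⟩ := DU.exists_subseq_tendsto_ev (g := fun k => g (n i k)) (d := 1)
      fun x => by
        rw [one_apply]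
        exact (hU x).comp (hn i).tendsto_atTop
    obtain ⟨ms, hms, h2⟩ := DV.exists_subseq_tendsto_ev (g := fun k => g (n i (ns k))) (d := d i)
      fun y => (hV i y).comp hns.tendsto_atTop
    refine ⟨ns ∘ ms, ?_, h2⟩
    filter_upwards [h1] with ω hω
    rw [PontryaginDual.ev_one] at hω
    exact hω.comp hms.tendsto_atTop
  choose ns hns1 hns2 using hsub
  obtain ⟨c, hc, hcm⟩ := exists_measurable_left_inverse_mul (fun i k => g (n i (ns i k))) d
    (ae_all_iff.2 hns1) (ae_all_iff.2 hns2) hd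
  ext l
  rw [mem_essMultiplicities_iff D, ae_multiplicity_tensor_ne_iff DU DV D hc hcm,
    not_ae_mul_ne_iff, Set.mem_mul]
  simp only [mem_essMultiplicities_iff DU, mem_essMultiplicities_iff DV]

end

end UnitaryRep

theorem mainTheorem5 {G H K J : Type*}
    [CommGroup G] [TopologicalSpace G] [IsTopologicalGroup G] [T2Space G]
    [LocallyCompactSpace G] [SecondCountableTopology G]
    [NormedAddCommGroup H] [InnerProductSpace ℂ H] [CompleteSpace H]
    [TopologicalSpace.SeparableSpace H]
    [NormedAddCommGroup K] [InnerProductSpace ℂ K] [CompleteSpace K]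
    [TopologicalSpace.SeparableSpace K]
    [Countable J]
    (U : UnitaryRep G H) (V : UnitaryRep G K)
    (g : ℕ → G) (n : J → ℕ → ℕ) (hn : ∀ i, StrictMono (n i)) (d : J → G)
    (hU : ∀ x : H, Tendsto (fun k => U (g k) x) atTop (𝓝 x))
    (hV : ∀ (i : J) (y : K), Tendsto (fun k => V (g (n i k)) y) atTop (𝓝 (V (d i) y)))
    (hd : Dense (Subgroup.closure (Set.range d) : Set G)) :
    (U.HasSimpleSpectrum → V.HasSimpleSpectrum → (U.tensor V).HasSimpleSpectrum) ∧
    ((∃ φ, U.IsCyclic φ) → (∃ ψ, V.IsCyclic ψ) → ∃ χ, (U.tensor V).IsCyclic χ) ∧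
    (U.tensor V).essMultiplicities = U.essMultiplicities * V.essMultiplicities := by
  have hmul := UnitaryRep.essMultiplicities_tensor g n hn d hU hV hd
  refine ⟨fun h1 h2 => ?_, ?_, hmul⟩
  · rw [UnitaryRep.HasSimpleSpectrum] at h1 h2 ⊢
    rw [hmul, h1, h2, Set.singleton_mul_singleton, one_mul]
  · rintro ⟨φ, hφ⟩ ⟨ψ, hψ⟩
    exact ⟨_, UnitaryRep.isCyclic_tensor U V g n hn d hU hV hd hφ hψ⟩
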